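/- Let $q\ge 2$ be an integer and let $s_q(n)$ denote the sum of the digits of $n\in\mathbb N_0$ in base $q$. For a sequence $(\boldsymbol y_n)_{n\ge 0}$ in $[0,1)^s$ and $N\ge 1$ let $$D_N((\boldsymbol y_n)_{n\ge0})=\sup_{[\boldsymbol a,\boldsymbol c)\subseteq[0,1)^s}\left|\frac{\#\{0\le n<N:\boldsymbol y_n\in[\boldsymbol a,\boldsymbol c)\}}{N}-\mathrm{vol}([\boldsymbol a,\boldsymbol c))\right|$$ be its discrepancy, the supremum being over all axis-parallel half-open intervals. For an integer $b\ge2$ and $n=a_0+a_1b+a_2b^2+\cdots$ in base $b$ put $\varphi_b(n)=\frac{a_0}{b}+\frac{a_1}{b^2}+\frac{a_2}{b^3}+\cdots$; the Halton sequence in bases $b_1,\dots,b_s\ge 2$ is $\boldsymbol x_n=(\varphi_{b_1}(n),\dots,\varphi_{b_s}(n))$. For integers $b\ge 2$ and $t\ge0$, a sequence $(\boldsymbol x_n)_{n\ge0}$ in $[0,1)^s$ is a $(t,s)$-sequence in base $b$ if for all integers $k\ge0$ and $m\ge t$, every elementary interval $\prod_{i=1}^s[a_ib^{-d_i},(a_i+1)b^{-d_i})$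 (with integers $d_i\ge0$, $0\le a_i<b^{d_i}$) of volume $b^{t-m}$ contains $\boldsymbol x_n$ for exactly $b^t$ of the indices $kb^m\le n<(k+1)b^m$. There is a constant $c_q^{(2)}>0$ depending only on $q$ such that the following holds for every integer $s\ge1$. 1. For all pairwise co-prime integers $b_1,\dots,b_s\ge2$ there is a constant $c^{(4)}_{q,s,b_1,\dots,b_s}>0$ such that the Halton sequence $(\boldsymbol x_n)_{n\ge0}$ in bases $b_1,\dots,b_s$ satisfies, for all integers $N\ge3$, $$\frac{c^{(2)}_q}{\sqrt{\log N}}\le D_N((\boldsymbol x_{s_q(n)})_{n\ge0})\le c^{(4)}_{q,s,b_1,\dots,b_s}\frac{(\log\log N)^s}{\sqrt{\log N}}.$$ 2. For all integers $b\ge2$ and $t\ge0$ there is a constant $c^{(5)}_{q,b,s,t}>0$ such that every $(t,s)$-sequence $(\boldsymbol x_n)_{n\ge0}$ in base $b$ satisfies, for all integers $N\ge3$, $$\frac{c^{(2)}_q}{\sqrt{\log N}}\le D_N((\boldsymbol x_{s_q(n)})_{n\ge0})\le c^{(5)}_{q,b,s,t}\frac{(\log\log N)^s}{\sqrt{\log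 N}}.$$ -/

import Mathlib

noncomputable section

/-- The `q`-ary sum-of-digits function. -/
def sumOfDigits (q n : ℕ) : ℕ := (Nat.digits q n).sum

/-- The radical inverse `∑ i, a_i / b ^ (i + 1)` of `n = ∑ i, a_i * b ^ i`
(`Nat.digits` lists the least significant digit first). -/
def radicalInverse (b n : ℕ) : ℝ :=
  ∑ i ∈ Finset.range (Nat.digits b n).length,
    ((Nat.digits b n).getD i 0 : ℝ) / (b : ℝ) ^ (i + 1)

/-- The Halton sequence in the bases `b 0, …, b (s - 1)`. -/
def haltonSeq {s : ℕ} (b : Fin s → ℕ) (n : ℕ) : Fin s → ℝ :=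
  fun i => radicalInverse (b i) n

/-- The half-open interval `∏ i, [a i, c i)`. -/
def box {s : ℕ} (a c : Fin s → ℝ) : Set (Fin s → ℝ) :=
  Set.univ.pi fun i => Set.Ico (a i) (c i)

open Classical in
/-- The signed local discrepancy of the first `N` points of `y` on `[a, c)`. -/
def localDiscrepancy {s : ℕ} (y : ℕ → Fin s → ℝ) (N : ℕ) (a c : Fin s → ℝ) : ℝ :=
  (((Finset.range N).filter fun n => y n ∈ box a c).card : ℝ) / (N : ℝ) - ∏ i, (c i - a i)

/-- The (extreme) discrepancy `D_N` of the first `N` points of `y`: the supremum of the absolute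
local discrepancy over all intervals `[a, c)` contained in `[0, 1)^s`. -/
def discrepancy {s : ℕ} (y : ℕ → Fin s → ℝ) (N : ℕ) : ℝ :=
  sSup {r : ℝ | ∃ a c : Fin s → ℝ, (∀ i, 0 ≤ a i ∧ a i ≤ c i ∧ c i ≤ 1) ∧
    r = |localDiscrepancy y N a c|}

/-- The elementary interval `∏ i, [a i * b ^ (-d i), (a i + 1) * b ^ (-d i))` in base `b`;
its volume is `b ^ (-∑ i, d i)`. -/
def elementaryInterval {s : ℕ} (b : ℕ) (a d : Fin s → ℕ) : Set (Fin s → ℝ) :=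
  box (fun i => (a i : ℝ) / (b : ℝ) ^ d i) (fun i => ((a i : ℝ) + 1) / (b : ℝ) ^ d i)

open Classical in
/-- `y` is a `(t, m, s)`-net in base `b`: its `b ^ m` points lie in `[0, 1)^s`, and every
elementary interval of volume `b ^ (t - m)`, that is with `∑ i, d i = m - t`, contains exactly
`b ^ t` of them (counted by index). -/
def IsNet (b t m s : ℕ) (y : Fin (b ^ m) → Fin s → ℝ) : Prop :=
  t ≤ m ∧ (∀ n i, y n i ∈ Set.Ico (0 : ℝ) 1) ∧
    ∀ a d : Fin s → ℕ, (∀ i, a i < b ^ d i) → ∑ i, d i = m - t →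
      (Finset.univ.filter fun n => y n ∈ elementaryInterval b a d).card = b ^ t

/-- `x` is a `(t, s)`-sequence in base `b`. -/
def IsTSSequence (b t s : ℕ) (x : ℕ → Fin s → ℝ) : Prop :=
  ∀ k m : ℕ, t ≤ m → IsNet b t m s fun j => x (k * b ^ m + (j : ℕ))

end

/-! For a box B let S(k) be the number of j < k with x_j in B, minus k·vol(B). Then 1_B(x_k) -
vol(B) = S(k+1) - S(k), so N times the local discrepancy of the points x_{s_q(n)} equals the sum
over n < N of S(s_q(n)+1) - S(s_q(n)).

For n < q^m the values s_q(n) spread smoothly over a range of width about √m, so such a sum of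
differences is O(q^m/√m)·sup|S| (`abs_sum_sub_shift_sumOfDigits_le`). Algebraically, the generating
function of s_q on [0, q^m) is (1 + X + ⋯ + X^(q-1))^m, and multiplying it by 1 - X leaves
coefficients of absolute sum O(q^m/√m). This is carried out for an element of a normed algebra whose
powers have norm at most 1, and then applied to the shift on bounded sequences.

Only S(k) with k = O(log N) is involved, because s_q(n) ≤ qm. The classical digit argument gives
S(k) = O((log k)^s) there (`HasAdicDeviation.abs_boxCount_sub_le`), whence the power of log log N.
Halton and (t,s)-sequences enter the upper bound only through `HasAdicDeviation`.

For the lower bound, s_q on [0, q^m) has standard deviation O(√m), so some value k is taken at least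
const·q^m/√m times. The single point x_k is then repeated that often inside arbitrarily small boxes.
Nothing is used about x except that it lies in [0,1)^s, which is why this constant depends on q
alone. -/

/-! ### Near-invariance of powers of a geometric sum under multiplication by x. -/

theorem sum_choose_mul_sub_sq (n : ℕ) :
    ∑ k ∈ Finset.range (n + 1), (n.choose k : ℝ) * ((n : ℝ) - 2 * k) ^ 2 = (n : ℝ) * 2 ^ n := by
  have h := congrArg (Polynomial.eval (1 / 2 : ℝ)) (bernsteinPolynomial.variance ℝ n)
  simp only [Polynomial.eval_finsetSum, bernsteinPolynomial, nsmul_eq_mul] at h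
  simp at h
  have h2 : ∑ k ∈ Finset.range (n + 1), (n.choose k : ℝ) * ((n : ℝ) - 2 * k) ^ 2
      = 4 * 2 ^ n * ∑ k ∈ Finset.range (n + 1), ((n : ℝ) * 2⁻¹ - k) ^ 2 *
        ((n.choose k : ℝ) * (2 ^ k)⁻¹ * (1 - 2⁻¹) ^ (n - k)) := by
    rw [Finset.mul_sum]
    refine Finset.sum_congr rfl fun k hk => ?_
    have hk' : k ≤ n := Nat.lt_succ_iff.mp (Finset.mem_range.mp hk)
    have : (1 - 2⁻¹ : ℝ) = 2⁻¹ := by norm_num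
    rw [this, ← inv_pow, mul_assoc (n.choose k : ℝ), ← pow_add, Nat.add_sub_cancel' hk', inv_pow]
    field_simp
    ring
  rw [h2, h]
  ring

/-- Cauchy–Schwarz against the binomial variance; this is where the square-root saving originates.
-/
theorem sum_choose_mul_abs_le (n : ℕ) :
    ∑ k ∈ Finset.range (n + 1), (n.choose k : ℝ) * |(n : ℝ) - 2 * k| ≤ 2 ^ n * √(n : ℝ) := by
  have hcs := Finset.sum_mul_sq_le_sq_mul_sq (Finset.range (n + 1))
    (fun k => √(n.choose k : ℝ)) (fun k => √(n.choose k : ℝ) * |(n : ℝ) - 2 * k|)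
  have e1 : ∀ k : ℕ, √(n.choose k : ℝ) * (√(n.choose k : ℝ) * |(n : ℝ) - 2 * k|)
      = (n.choose k : ℝ) * |(n : ℝ) - 2 * k| := fun k => by
    rw [← mul_assoc, Real.mul_self_sqrt (Nat.cast_nonneg _)]
  have e2 : ∀ k : ℕ, √(n.choose k : ℝ) ^ 2 = n.choose k := fun k =>
    Real.sq_sqrt (Nat.cast_nonneg _)
  simp only [e1, mul_pow, e2, sq_abs, sum_choose_mul_sub_sq] at hcs
  have e3 : ∑ k ∈ Finset.range (n + 1), (n.choose k : ℝ) = 2 ^ n := by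
    exact_mod_cast Nat.sum_range_choose n
  rw [e3] at hcs
  refine (sq_le_sq₀ (Finset.sum_nonneg fun k _ => by positivity) (by positivity)).1 ?_
  rw [mul_pow, Real.sq_sqrt (Nat.cast_nonneg _)]
  linarith [hcs]

section NormedRing

variable {R : Type*} [NormedRing R] [NormedAlgebra ℝ R]

/-- The coefficient C(j,k) - C(j,k-1) of X^k in (1-X)(1+X)^j equals C(j+1,k)(j+1-2k)/(j+1). The
identity is checked for real polynomials and then evaluated at x, so R need not be commutative. -/
theorem one_sub_mul_one_add_pow (x : R) (j : ℕ) :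
    ((j + 1 : ℕ) : ℝ) • ((1 - x) * (1 + x) ^ j) =
      ∑ k ∈ Finset.range (j + 2),
        (((j + 1).choose k : ℝ) * (((j + 1 : ℕ) : ℝ) - 2 * k)) • x ^ k := by
  have h : (Polynomial.C ((j + 1 : ℕ) : ℝ)) * ((1 - Polynomial.X) * (1 + Polynomial.X) ^ j) =
      ∑ k ∈ Finset.range (j + 2),
        Polynomial.C (((j + 1).choose k : ℝ) * (((j + 1 : ℕ) : ℝ) - 2 * k)) *
          Polynomial.X ^ k := by
    ext k
    simp only [Polynomial.finsetSum_coeff, Polynomial.coeff_C_mul, Polynomial.coeff_X_pow,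
      mul_ite, mul_one, mul_zero, Finset.sum_ite_eq, Finset.mem_range]
    rw [sub_mul, one_mul, Polynomial.coeff_sub]
    have hk0 : ¬ k < j + 2 → ((j + 1).choose k : ℝ) = 0 := fun hk => by
      rw [Nat.choose_eq_zero_of_lt (by omega)]; simp
    have : (if k < j + 2 then ((j + 1).choose k : ℝ) * (((j + 1 : ℕ) : ℝ) - 2 * k) else 0)
        = ((j + 1).choose k : ℝ) * (((j + 1 : ℕ) : ℝ) - 2 * k) := by
      split_ifs with hk
      · rfl
      · rw [hk0 hk, zero_mul]
    rw [this]
    rcases k with _ | k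
    · simp [Polynomial.coeff_one_add_X_pow]
    · rw [Polynomial.coeff_X_mul, Polynomial.coeff_one_add_X_pow, Polynomial.coeff_one_add_X_pow]
      have h1 := Nat.add_one_mul_choose_eq j k
      have h2 : ((j + 1).choose (k + 1) : ℝ) = j.choose k + j.choose (k + 1) := by
        exact_mod_cast Nat.choose_succ_succ j k
      have h1' : ((j : ℝ) + 1) * j.choose k = (j + 1).choose (k + 1) * (k + 1) := by
        exact_mod_cast h1
      push_cast
      linear_combination (-2) * h1' - ((j : ℝ) + 1) * h2
  have h' := congrArg (Polynomial.aeval x) h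
  simpa [map_sum, Algebra.smul_def] using h'

theorem norm_one_sub_mul_one_add_pow_le {x : R} (hx : ∀ k : ℕ, ‖x ^ k‖ ≤ 1) (j : ℕ) :
    ‖(1 - x) * (1 + x) ^ j‖ ≤ 2 ^ (j + 1) / √(j + 1) := by
  have h := congrArg norm (one_sub_mul_one_add_pow x j)
  rw [norm_smul, Real.norm_natCast] at h
  have h2 : ‖∑ k ∈ Finset.range (j + 2),
        (((j + 1).choose k : ℝ) * (((j + 1 : ℕ) : ℝ) - 2 * k)) • x ^ k‖
      ≤ 2 ^ (j + 1) * √((j + 1 : ℕ) : ℝ) := by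
    refine (norm_sum_le _ _).trans (le_trans ?_ (sum_choose_mul_abs_le (j + 1)))
    refine Finset.sum_le_sum fun k _ => ?_
    rw [norm_smul, norm_mul, Real.norm_natCast, Real.norm_eq_abs]
    exact mul_le_of_le_one_right (by positivity) (hx k)
  rw [← h] at h2
  push_cast at h2
  rw [le_div_iff₀ (by positivity)]
  have hs : 0 < √((j : ℝ) + 1) := by positivity
  have hs2 : √((j : ℝ) + 1) * √((j : ℝ) + 1) = j + 1 := Real.mul_self_sqrt (by positivity)
  refine le_of_mul_le_mul_right ?_ hs
  calc _ = ((j : ℝ) + 1) * ‖(1 - x) * (1 + x) ^ j‖ := by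
        rw [mul_assoc, hs2, mul_comm]
    _ ≤ _ := h2

theorem norm_pow_le_pow_of_norm_one_le {R : Type*} [NormedRing R] {y : R}
    (h1 : ‖(1 : R)‖ ≤ 1) {c : ℝ} (hy : ‖y‖ ≤ c) (k : ℕ) :
    ‖y ^ k‖ ≤ c ^ k := by
  rcases k with _ | k
  · simpa using h1
  · exact (norm_pow_le' y k.succ_pos).trans (pow_le_pow_left₀ (norm_nonneg _) hy _)

/-- For J binomial with parameters m and p/(p+r), Cauchy–Schwarz bounds E[(J+1)^(-1/2)]² by
E[1/(J+1)], and (m+1)C(m,j) = (j+1)C(m+1,j+1) turns the latter into part of a binomial expansion of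
exponent m+1. -/
theorem sum_choose_div_sqrt_le {p r : ℝ} (hp : 0 < p) (hr : 0 ≤ r) (m : ℕ) :
    ∑ j ∈ Finset.range (m + 1), (m.choose j : ℝ) * p ^ j * r ^ (m - j) / √(j + 1) ≤
      √((p + r) / p) * ((p + r) ^ m / √(m + 1)) := by
  set w : ℕ → ℝ := fun j => (m.choose j : ℝ) * p ^ j * r ^ (m - j) with hw
  have hw0 : ∀ j, 0 ≤ w j := fun j => by positivity
  have hsum : ∑ j ∈ Finset.range (m + 1), w j = (p + r) ^ m := by
    rw [add_pow]
    exact Finset.sum_congr rfl fun j _ => by simp only [hw]; ring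
  have hinv : ∑ j ∈ Finset.range (m + 1), w j / (j + 1) ≤ (p + r) ^ (m + 1) / (p * (m + 1)) := by
    rw [le_div_iff₀ (by positivity), Finset.sum_mul, add_pow, Finset.sum_range_succ' _ (m + 1)]
    refine le_trans (Finset.sum_le_sum fun j _ => le_of_eq ?_) (le_add_of_nonneg_right ?_)
    swap; · positivity
    have h1 : ((m : ℝ) + 1) * m.choose j = (m + 1).choose (j + 1) * (j + 1) := by
      exact_mod_cast Nat.add_one_mul_choose_eq m j
    rw [show m + 1 - (j + 1) = m - j by omega, div_mul_eq_mul_div, div_eq_iff (by positivity)]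
    simp only [hw]
    linear_combination (p ^ (j + 1) * r ^ (m - j)) * h1
  have hcs := Finset.sum_mul_sq_le_sq_mul_sq (Finset.range (m + 1))
    (fun j => √(w j)) (fun j => √(w j / (j + 1)))
  have e1 : ∀ j : ℕ, √(w j) * √(w j / (j + 1)) = w j / √(j + 1) := fun j => by
    rw [Real.sqrt_div (hw0 j), ← mul_div_assoc, Real.mul_self_sqrt (hw0 j)]
  have e2 : ∀ j : ℕ, √(w j) ^ 2 = w j := fun j => Real.sq_sqrt (hw0 j)
  have e3 : ∀ j : ℕ, √(w j / (j + 1)) ^ 2 = w j / (j + 1) := fun j =>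
    Real.sq_sqrt (div_nonneg (hw0 j) (by positivity))
  simp only [e1, e2, e3, hsum] at hcs
  refine (sq_le_sq₀ (Finset.sum_nonneg fun j _ => div_nonneg (hw0 j) (by positivity))
    (by positivity)).1 (hcs.trans ((mul_le_mul_of_nonneg_left hinv (by positivity)).trans
    (le_of_eq ?_)))
  rw [mul_pow, div_pow, Real.sq_sqrt (by positivity), Real.sq_sqrt (by positivity)]
  field_simp
  ring

/-- The geometric sum `1 + x + ⋯ + x ^ (q - 1)` spreads out: its powers are almost invariant under
multiplication by `x`. -/
theorem norm_one_sub_mul_geom_sum_pow_le {x : R} (hx : ∀ k : ℕ, ‖x ^ k‖ ≤ 1) {q : ℕ} (hq : 2 ≤ q)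
    (m : ℕ) :
    ‖(1 - x) * (∑ i ∈ Finset.range q, x ^ i) ^ m‖ ≤ 2 * q * ((q : ℝ) ^ m / √(m + 1)) := by
  obtain ⟨r, rfl⟩ := Nat.exists_eq_add_of_le hq
  set y : R := ∑ i ∈ Finset.range r, x ^ (2 + i) with hy
  -- Cancellation is drawn from 1 + x alone; the other q - 2 terms are bounded trivially, and the
  -- binomial theorem averages the saving over the number j of factors 1 + x.
  have hA : ∑ i ∈ Finset.range (2 + r), x ^ i = (1 + x) + y := by
    rw [Finset.sum_range_add, Finset.sum_range_succ, Finset.sum_range_one, pow_zero, pow_one]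
  have hyn : ‖y‖ ≤ r := by
    refine (norm_sum_le _ _).trans ?_
    simpa using Finset.sum_le_sum fun i (_ : i ∈ Finset.range r) => hx (2 + i)
  have hcomm : Commute (1 + x) y :=
    Commute.sum_right _ _ _ fun i _ => ((Commute.one_left x).add_left (Commute.refl x)).pow_right _
  rw [hA, hcomm.add_pow, Finset.mul_sum]
  have key : ∀ j ∈ Finset.range (m + 1),
      ‖(1 - x) * ((1 + x) ^ j * y ^ (m - j) * (m.choose j : R))‖ ≤
        2 * ((m.choose j : ℝ) * 2 ^ j * (r : ℝ) ^ (m - j) / √(j + 1)) := fun j _ => by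
    have : (1 - x) * ((1 + x) ^ j * y ^ (m - j) * (m.choose j : R)) =
        (m.choose j : ℝ) • (((1 - x) * (1 + x) ^ j) * y ^ (m - j)) := by
      rw [Algebra.smul_def, map_natCast, (Nat.cast_commute (m.choose j) _).eq]
      simp only [mul_assoc]
    rw [this, norm_smul, Real.norm_natCast]
    calc _ ≤ (m.choose j : ℝ) * (2 ^ (j + 1) / √(j + 1) * (r : ℝ) ^ (m - j)) := by
          refine mul_le_mul_of_nonneg_left ((norm_mul_le _ _).trans ?_) (by positivity)
          exact mul_le_mul (norm_one_sub_mul_one_add_pow_le hx j)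
            (norm_pow_le_pow_of_norm_one_le (by simpa using hx 0) hyn _) (norm_nonneg _)
            (by positivity)
      _ = _ := by rw [pow_succ]; ring
  refine (norm_sum_le _ _).trans ((Finset.sum_le_sum key).trans ?_)
  rw [← Finset.mul_sum, mul_assoc]
  refine mul_le_mul_of_nonneg_left ((sum_choose_div_sqrt_le two_pos (Nat.cast_nonneg r) m).trans ?_)
    two_pos.le
  push_cast
  refine mul_le_mul_of_nonneg_right ?_ (by positivity)
  rw [Real.sqrt_le_left (by positivity)]
  nlinarith [Nat.cast_nonneg (α := ℝ) r]

/-! ### The generating function of the sum of digits up to an arbitrary N. -/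

theorem sumOfDigits_mul_add {q : ℕ} (hq : 2 ≤ q) (n : ℕ) {i : ℕ} (hi : i < q) :
    sumOfDigits q (q * n + i) = sumOfDigits q n + i := by
  rcases Nat.eq_zero_or_pos (q * n + i) with h | h
  · have h2 : n = 0 := by
      rcases Nat.eq_zero_or_pos n with h' | h'
      · exact h'
      · have := Nat.mul_pos (by omega : 0 < q) h'
        omega
    subst h2
    have : i = 0 := by omega
    subst this
    simp
  · unfold sumOfDigits
    rw [Nat.digits_def' (by omega) h, Nat.mul_add_mod, Nat.mod_eq_of_lt hi,
      Nat.mul_add_div (by omega), Nat.div_eq_of_lt hi]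
    simp [add_comm]

theorem sum_range_mul_eq {M : Type*} [AddCommMonoid M] (f : ℕ → M) (q N : ℕ) :
    ∑ n ∈ Finset.range (q * N), f n =
      ∑ n ∈ Finset.range N, ∑ i ∈ Finset.range q, f (q * n + i) := by
  induction N with
  | zero => simp
  | succ N ih => rw [Nat.mul_succ, Finset.sum_range_add, ih, Finset.sum_range_succ]

theorem sum_range_mul_add_pow_sumOfDigits {R : Type*} [Semiring R] {q : ℕ} (hq : 2 ≤ q)
    (x : R) (N : ℕ) {r : ℕ} (hr : r < q) :
    ∑ n ∈ Finset.range (q * N + r), x ^ sumOfDigits q n =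
      (∑ i ∈ Finset.range q, x ^ i) * (∑ n ∈ Finset.range N, x ^ sumOfDigits q n) +
        (∑ i ∈ Finset.range r, x ^ i) * x ^ sumOfDigits q N := by
  rw [Finset.sum_range_add, sum_range_mul_eq, Finset.mul_sum, Finset.sum_mul]
  congr 1
  · refine Finset.sum_congr rfl fun n _ => ?_
    rw [Finset.sum_mul]
    refine Finset.sum_congr rfl fun i hi => ?_
    rw [sumOfDigits_mul_add hq n (Finset.mem_range.1 hi), ← pow_add, add_comm]
  · refine Finset.sum_congr rfl fun i hi => ?_
    rw [sumOfDigits_mul_add hq N ((Finset.mem_range.1 hi).trans hr), ← pow_add, add_comm]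

/-- Consecutive terms have ratio at least 2/(3/2) = 4/3, so the sum is comparable to its last term.
-/
theorem sum_pow_div_sqrt_le {q : ℝ} (hq : 2 ≤ q) (m : ℕ) :
    ∑ i ∈ Finset.range m, q ^ i / √(i + 1) ≤ 3 * (q ^ m / √(m + 1)) := by
  induction m with
  | zero => simp
  | succ m ih =>
    rw [Finset.sum_range_succ]
    refine (add_le_add_left ih _).trans ?_
    have h1 : √((m + 1 : ℕ) + 1 : ℝ) ≤ 3 / 2 * √(m + 1) := by
      rw [Real.sqrt_le_left (by positivity), mul_pow, Real.sq_sqrt (by positivity)]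
      push_cast
      nlinarith [Nat.cast_nonneg (α := ℝ) m]
    have h2 : 0 < q ^ m := by positivity
    rw [show 3 * (q ^ m / √((m : ℝ) + 1)) + q ^ m / √((m : ℝ) + 1) = 4 * q ^ m / √((m : ℝ) + 1) by
      ring, ← mul_div_assoc, div_le_div_iff₀ (by positivity) (by positivity)]
    calc 4 * q ^ m * √((m + 1 : ℕ) + 1 : ℝ) ≤ 4 * q ^ m * (3 / 2 * √(m + 1)) := by gcongr
      _ = 3 * (q ^ m * 2) * √(m + 1) := by ring
      _ ≤ 3 * q ^ (m + 1) * √(m + 1) := by rw [pow_succ]; gcongr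

theorem norm_one_sub_mul_sum_pow_sumOfDigits_le {x : R} (hx : ∀ k : ℕ, ‖x ^ k‖ ≤ 1) {q : ℕ}
    (hq : 2 ≤ q) {m N : ℕ} (hN : N < q ^ m) :
    ‖(1 - x) * ∑ n ∈ Finset.range N, x ^ sumOfDigits q n‖ ≤
      6 * (q : ℝ) ^ 2 * ((q : ℝ) ^ m / √(m + 1)) := by
  -- Stripping the last digit of N moves one geometric sum into the prefactor, so the induction must
  -- allow an arbitrary power j. Each stripped digit leaves a remainder that still carries j such
  -- factors, to which the previous bound applies.
  have key : ∀ m j N : ℕ, N < q ^ m →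
      ‖(1 - x) * (∑ i ∈ Finset.range q, x ^ i) ^ j * ∑ n ∈ Finset.range N, x ^ sumOfDigits q n‖ ≤
        ∑ i ∈ Finset.range m, 2 * (q : ℝ) ^ 2 * ((q : ℝ) ^ (j + i) / √((j + i : ℕ) + 1)) := by
    intro m
    induction m with
    | zero =>
      intro j N hN
      have : N = 0 := by simpa using hN
      subst this
      simp
    | succ m ih =>
      intro j N hN
      have hr : N % q < q := Nat.mod_lt _ (by omega)
      have hN' : N / q < q ^ m := Nat.div_lt_of_lt_mul (by rwa [pow_succ'] at hN)
      rw [← Nat.div_add_mod N q, sum_range_mul_add_pow_sumOfDigits hq x _ hr, mul_add,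
        ← mul_assoc, mul_assoc (1 - x), ← pow_succ, Finset.sum_range_succ']
      refine (norm_add_le _ _).trans (add_le_add ((ih (j + 1) _ hN').trans (le_of_eq ?_)) ?_)
      · refine Finset.sum_congr rfl fun i _ => ?_
        rw [show j + 1 + i = j + (i + 1) by ring]
      · have h1 : ‖∑ i ∈ Finset.range (N % q), x ^ i‖ ≤ q := by
          refine (norm_sum_le _ _).trans
            ((Finset.sum_le_sum fun i _ => hx i).trans ?_)
          simpa using hr.le
        have h2 : ‖(∑ i ∈ Finset.range (N % q), x ^ i) * x ^ sumOfDigits q (N / q)‖ ≤ q * 1 :=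
          (norm_mul_le _ _).trans (mul_le_mul h1 (hx _) (norm_nonneg _) (by positivity))
        refine (norm_mul_le _ _).trans ((mul_le_mul (norm_one_sub_mul_geom_sum_pow_le hx hq j) h2
          (norm_nonneg _) (by positivity)).trans (le_of_eq ?_))
        simp only [add_zero]
        ring
  have h := key m 0 N hN
  simp only [pow_zero, mul_one, zero_add] at h
  refine h.trans ?_
  rw [← Finset.mul_sum]
  have := sum_pow_div_sqrt_le (q := q) (by exact_mod_cast hq) m
  calc _ ≤ 2 * (q : ℝ) ^ 2 * (3 * ((q : ℝ) ^ m / √(m + 1))) := by gcongr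
    _ = _ := by ring

theorem norm_sum_pow_sub_pow_succ_sumOfDigits_le {x : R} (hx : ∀ k : ℕ, ‖x ^ k‖ ≤ 1) {q : ℕ}
    (hq : 2 ≤ q) {m N : ℕ} (hN : N < q ^ m) :
    ‖∑ n ∈ Finset.range N, (x ^ (sumOfDigits q n + 1) - x ^ sumOfDigits q n)‖ ≤
      6 * (q : ℝ) ^ 2 * ((q : ℝ) ^ m / √(m + 1)) := by
  refine le_of_eq_of_le ?_ (norm_one_sub_mul_sum_pow_sumOfDigits_le hx hq hN)
  rw [← norm_neg, ← Finset.sum_neg_distrib, Finset.mul_sum]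
  refine congrArg norm (Finset.sum_congr rfl fun n _ => ?_)
  rw [sub_mul, one_mul, ← pow_succ', neg_sub]

end NormedRing

/-! ### Transfer to bounded real sequences via the shift operator. -/

open BoundedContinuousFunction in
/-- The shift `f ↦ f (· + 1)` on bounded sequences. -/
noncomputable def boundedShift : (ℕ →ᵇ ℝ) →L[ℝ] (ℕ →ᵇ ℝ) :=
  LinearMap.mkContinuous
    { toFun := fun f => f.compContinuous ⟨Nat.succ, continuous_of_discreteTopology⟩
      map_add' := fun _ _ => rfl
      map_smul' := fun _ _ => rfl } 1
    fun f => by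
      rw [one_mul]
      exact (BoundedContinuousFunction.norm_le (norm_nonneg f)).2 fun n => f.norm_coe_le_norm _

theorem boundedShift_pow_apply (k : ℕ) (f : BoundedContinuousFunction ℕ ℝ) (n : ℕ) :
    (boundedShift ^ k) f n = f (n + k) := by
  induction k generalizing f with
  | zero => rfl
  | succ k ih =>
    rw [pow_succ]
    exact (ih (boundedShift f)).trans rfl

theorem norm_boundedShift_pow_le (k : ℕ) : ‖boundedShift ^ k‖ ≤ 1 :=
  ContinuousLinearMap.opNorm_le_bound _ zero_le_one fun f => by
    rw [one_mul]
    refine (BoundedContinuousFunction.norm_le (norm_nonneg f)).2 fun n => ?_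
    rw [boundedShift_pow_apply]
    exact f.norm_coe_le_norm _

/-- The operator bound for the shift is applied to f and read off at 0, where the k-th power of the
shift gives f k. -/
theorem abs_sum_sub_shift_sumOfDigits_le {q : ℕ} (hq : 2 ≤ q) {m N : ℕ} (hN : N < q ^ m)
    {f : ℕ → ℝ} {M : ℝ} (hM : 0 ≤ M) (hf : ∀ k, |f k| ≤ M) :
    |∑ n ∈ Finset.range N, (f (sumOfDigits q n + 1) - f (sumOfDigits q n))| ≤
      6 * (q : ℝ) ^ 2 * ((q : ℝ) ^ m / √(m + 1)) * M := by
  let g : BoundedContinuousFunction ℕ ℝ :=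
    BoundedContinuousFunction.ofNormedAddCommGroupDiscrete f M hf
  have hg : ‖g‖ ≤ M := (BoundedContinuousFunction.norm_le hM).2 hf
  have h := norm_sum_pow_sub_pow_succ_sumOfDigits_le (x := boundedShift)
    norm_boundedShift_pow_le hq hN
  set T : BoundedContinuousFunction ℕ ℝ →L[ℝ] BoundedContinuousFunction ℕ ℝ :=
    ∑ n ∈ Finset.range N, (boundedShift ^ (sumOfDigits q n + 1) - boundedShift ^ sumOfDigits q n)
    with hT
  have h2 : T g 0 = ∑ n ∈ Finset.range N, (f (sumOfDigits q n + 1) - f (sumOfDigits q n)) := by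
    rw [hT, sum_apply, BoundedContinuousFunction.coe_sum, Finset.sum_apply]
    refine Finset.sum_congr rfl fun n _ => ?_
    rw [sub_apply, BoundedContinuousFunction.sub_apply, boundedShift_pow_apply,
      boundedShift_pow_apply, zero_add, zero_add]
    rfl
  rw [← h2]
  refine ((T g).norm_coe_le_norm 0).trans ((T.le_opNorm g).trans ?_)
  exact mul_le_mul h hg (norm_nonneg _) (by positivity)

/-! ### Box counts and decompositions into b-adic intervals. -/

/-- The real-valued indicator function of the interval `[a, c)`. -/
noncomputable def icoInd (a c : ℝ) : ℝ → ℝ := (Set.Ico a c).indicator fun _ => 1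

theorem icoInd_nonneg (a c t : ℝ) : 0 ≤ icoInd a c t :=
  Set.indicator_nonneg (fun _ _ => zero_le_one) t

theorem icoInd_mono {a a' c c' : ℝ} (ha : a' ≤ a) (hc : c ≤ c') (t : ℝ) :
    icoInd a c t ≤ icoInd a' c' t :=
  Set.indicator_le_indicator_of_subset (Set.Ico_subset_Ico ha hc) (fun _ => zero_le_one) t

theorem icoInd_add {a m c : ℝ} (h1 : a ≤ m) (h2 : m ≤ c) (t : ℝ) :
    icoInd a m t + icoInd m c t = icoInd a c t := by
  unfold icoInd
  rw [← Set.Ico_union_Ico_eq_Ico h1 h2, Set.indicator_union_of_disjoint]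
  exact Set.disjoint_left.2 fun x hx hx' => not_le.2 hx.2 hx'.1

/-- The number of the first `K` points of `y` in `[a, c)`, as a real number. -/
noncomputable def boxCount {s : ℕ} (y : ℕ → Fin s → ℝ) (K : ℕ) (a c : Fin s → ℝ) : ℝ :=
  ∑ n ∈ Finset.range K, ∏ i, icoInd (a i) (c i) (y n i)

open Classical in
theorem boxCount_eq_card {s : ℕ} (y : ℕ → Fin s → ℝ) (K : ℕ) (a c : Fin s → ℝ) :
    boxCount y K a c = ((Finset.range K).filter fun n => y n ∈ box a c).card := by
  rw [Finset.card_filter]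
  push_cast
  refine Finset.sum_congr rfl fun n _ => ?_
  simp only [icoInd, Set.indicator_apply, Finset.prod_boole, Finset.mem_univ, true_imp_iff, box,
    Set.mem_univ_pi]

theorem boxCount_mono {s : ℕ} (y : ℕ → Fin s → ℝ) (K : ℕ) {a a' c c' : Fin s → ℝ}
    (ha : ∀ i, a' i ≤ a i) (hc : ∀ i, c i ≤ c' i) : boxCount y K a c ≤ boxCount y K a' c' :=
  Finset.sum_le_sum fun _ _ => Finset.prod_le_prod (fun _ _ => icoInd_nonneg _ _ _)
    fun i _ => icoInd_mono (ha i) (hc i) _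

/-- `f` is a linear combination, with coefficients of absolute sum at most `L`, of indicators of
`b`-adic intervals indexed by `T`, and `v` is the corresponding combination of their lengths. -/
def IsAdicCombination (b : ℕ) (T : Finset (ℕ × ℕ)) (L : ℝ) (f : ℝ → ℝ) (v : ℝ) : Prop :=
  ∃ ε : ℕ × ℕ → ℝ,
    (∀ t, f t = ∑ e ∈ T, ε e * icoInd ((e.1 : ℝ) / (b : ℝ) ^ e.2) (((e.1 : ℝ) + 1) / (b : ℝ) ^ e.2) t) ∧
    v = ∑ e ∈ T, ε e * (1 / (b : ℝ) ^ e.2) ∧ ∑ e ∈ T, |ε e| ≤ L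

namespace IsAdicCombination

variable {b : ℕ} {T : Finset (ℕ × ℕ)} {L L' : ℝ} {f g : ℝ → ℝ} {v w : ℝ}

theorem zero (b : ℕ) (T : Finset (ℕ × ℕ)) {L : ℝ} (hL : 0 ≤ L) :
    IsAdicCombination b T L (fun _ => 0) 0 :=
  ⟨fun _ => 0, by simp, by simp, by simpa⟩

theorem mono (h : IsAdicCombination b T L f v) (hL : L ≤ L') : IsAdicCombination b T L' f v := by
  obtain ⟨ε, h1, h2, h3⟩ := h
  exact ⟨ε, h1, h2, h3.trans hL⟩

theorem add (hf : IsAdicCombination b T L f v) (hg : IsAdicCombination b T L' g w) :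
    IsAdicCombination b T (L + L') (fun t => f t + g t) (v + w) := by
  obtain ⟨ε, h1, h2, h3⟩ := hf
  obtain ⟨δ, k1, k2, k3⟩ := hg
  refine ⟨fun e => ε e + δ e, fun t => ?_, ?_, ?_⟩
  · simp only [h1, k1, add_mul, Finset.sum_add_distrib]
  · simp only [h2, k2, add_mul, Finset.sum_add_distrib]
  · refine (Finset.sum_le_sum fun e _ => abs_add_le (ε e) (δ e)).trans ?_
    rw [Finset.sum_add_distrib]
    exact add_le_add h3 k3

theorem neg (hf : IsAdicCombination b T L f v) :
    IsAdicCombination b T L (fun t => -f t) (-v) := by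
  obtain ⟨ε, h1, h2, h3⟩ := hf
  refine ⟨fun e => -ε e, fun t => ?_, ?_, ?_⟩
  · simp only [h1, neg_mul, Finset.sum_neg_distrib]
  · simp only [h2, neg_mul, Finset.sum_neg_distrib]
  · simpa only [abs_neg] using h3

theorem adic {e : ℕ × ℕ} (he : e ∈ T) :
    IsAdicCombination b T 1
      (icoInd ((e.1 : ℝ) / (b : ℝ) ^ e.2) (((e.1 : ℝ) + 1) / (b : ℝ) ^ e.2))
      (1 / (b : ℝ) ^ e.2) := by
  classical
  refine ⟨fun e' => if e' = e then 1 else 0, fun t => ?_, ?_, ?_⟩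
  · simp [he]
  · simp [he]
  · simp [he, apply_ite abs]

theorem initial_extend {F d : ℕ} (hb : 0 < b) (hT : ∀ d ≤ F, ∀ a < b ^ d, (a, d) ∈ T) (hd : d ≤ F)
    {u : ℕ} (h : IsAdicCombination b T L (icoInd 0 ((u : ℝ) / (b : ℝ) ^ d)) ((u : ℝ) / (b : ℝ) ^ d))
    {r : ℕ} (hr : u + r ≤ b ^ d) :
    IsAdicCombination b T (L + r) (icoInd 0 (((u + r : ℕ) : ℝ) / (b : ℝ) ^ d))
      (((u + r : ℕ) : ℝ) / (b : ℝ) ^ d) := by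
  have hb' : (0 : ℝ) < b := by exact_mod_cast hb
  induction r with
  | zero => simpa using h
  | succ r ih =>
    have h1 := (ih (by omega)).add (adic (b := b) (hT d hd (u + r) (by omega)))
    have h2 : (fun t => icoInd 0 (((u + r : ℕ) : ℝ) / (b : ℝ) ^ d) t +
        icoInd (((u + r : ℕ) : ℝ) / (b : ℝ) ^ d) ((((u + r : ℕ) : ℝ) + 1) / (b : ℝ) ^ d) t) =
        icoInd 0 (((u + (r + 1) : ℕ) : ℝ) / (b : ℝ) ^ d) := by
      funext t
      rw [icoInd_add (by positivity) (by gcongr; linarith)]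
      push_cast
      ring_nf
    rw [h2] at h1
    convert h1 using 1
    · push_cast; ring
    · push_cast; ring

/-- Following the base-b expansion of the endpoint, each digit position adds fewer than b intervals
of its level. The cost is linear in d, which later becomes one logarithm per coordinate; the summand
1 pays for [0,1) itself. -/
theorem initial {F : ℕ} (hb : 2 ≤ b) (hT : ∀ d ≤ F, ∀ a < b ^ d, (a, d) ∈ T) {d : ℕ} (hd : d ≤ F)
    {u : ℕ} (hu : u ≤ b ^ d) :
    IsAdicCombination b T (1 + d * b) (icoInd 0 ((u : ℝ) / (b : ℝ) ^ d))
      ((u : ℝ) / (b : ℝ) ^ d) := by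
  have hb' : (0 : ℝ) < b := by exact_mod_cast (by omega : 0 < b)
  induction d generalizing u with
  | zero =>
    have h0 : IsAdicCombination b T 0 (icoInd 0 (((0 : ℕ) : ℝ) / (b : ℝ) ^ 0))
        (((0 : ℕ) : ℝ) / (b : ℝ) ^ 0) := by
      have : icoInd 0 (((0 : ℕ) : ℝ) / (b : ℝ) ^ 0) = fun _ => 0 := by
        funext t; simp [icoInd]
      rw [this]
      simpa using zero b T le_rfl
    have h := initial_extend (by omega) hT hd h0 (r := u) (by simpa using hu)
    rw [zero_add, zero_add] at h
    refine h.mono ?_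
    have : (u : ℝ) ≤ 1 := by exact_mod_cast (by simpa using hu)
    simpa using this
  | succ d ih =>
    have hdiv : u / b ≤ b ^ d := Nat.div_le_of_le_mul (by rwa [pow_succ'] at hu)
    have h := ih (by omega) hdiv
    have e : ((u / b : ℕ) : ℝ) / (b : ℝ) ^ d = ((b * (u / b) : ℕ) : ℝ) / (b : ℝ) ^ (d + 1) := by
      rw [pow_succ']
      push_cast
      rw [mul_div_mul_left _ _ hb'.ne']
    rw [e] at h
    have h' := initial_extend (by omega) hT hd h (r := u % b) (by rwa [Nat.div_add_mod])
    rw [Nat.div_add_mod] at h'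
    refine h'.mono ?_
    have : ((u % b : ℕ) : ℝ) ≤ b := by exact_mod_cast (Nat.mod_lt u (by omega)).le
    push_cast
    linarith

theorem interval {F : ℕ} (hb : 2 ≤ b) (hT : ∀ d ≤ F, ∀ a < b ^ d, (a, d) ∈ T)
    {u w : ℕ} (huw : u ≤ w) (hw : w ≤ b ^ F) :
    IsAdicCombination b T (2 * (1 + F * b)) (icoInd ((u : ℝ) / (b : ℝ) ^ F) ((w : ℝ) / (b : ℝ) ^ F))
      ((w : ℝ) / (b : ℝ) ^ F - (u : ℝ) / (b : ℝ) ^ F) := by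
  have hb' : (0 : ℝ) < b := by exact_mod_cast (by omega : 0 < b)
  have h := (initial hb hT le_rfl hw).add (initial hb hT le_rfl (huw.trans hw)).neg
  have e : (fun t => icoInd 0 ((w : ℝ) / (b : ℝ) ^ F) t + -icoInd 0 ((u : ℝ) / (b : ℝ) ^ F) t) =
      icoInd ((u : ℝ) / (b : ℝ) ^ F) ((w : ℝ) / (b : ℝ) ^ F) := by
    funext t
    rw [← icoInd_add (a := 0) (m := (u : ℝ) / (b : ℝ) ^ F) (c := (w : ℝ) / (b : ℝ) ^ F)
      (by positivity) (by gcongr)]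
    ring
  rw [e] at h
  convert h using 1 <;> ring

end IsAdicCombination

/-! ### From adic boxes to arbitrary boxes. -/

/-- In every interval that is `b i`-adic in coordinate `i`, the number of the first `K` points of
`y` deviates by at most `C` from the expected one, for all `K`. -/
def HasAdicDeviation {s : ℕ} (y : ℕ → Fin s → ℝ) (b : Fin s → ℕ) (C : ℝ) : Prop :=
  ∀ (K : ℕ) (a d : Fin s → ℕ), (∀ i, a i < b i ^ d i) →
    |boxCount y K (fun i => (a i : ℝ) / (b i : ℝ) ^ d i) (fun i => ((a i : ℝ) + 1) / (b i : ℝ) ^ d i) -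
      K * ∏ i, (1 / (b i : ℝ) ^ d i)| ≤ C

/-- Expanding the product over coordinates gives a combination of deviations on adic boxes whose
coefficients have absolute sum at most ∏ L_i. -/
theorem HasAdicDeviation.abs_sum_prod_sub_le {s : ℕ} {y : ℕ → Fin s → ℝ} {b : Fin s → ℕ} {C : ℝ}
    (h : HasAdicDeviation y b C) (hC : 0 ≤ C) (K : ℕ) {T : Fin s → Finset (ℕ × ℕ)}
    (hT : ∀ i, ∀ e ∈ T i, e.1 < b i ^ e.2) {L : Fin s → ℝ}
    {f : Fin s → ℝ → ℝ} {v : Fin s → ℝ}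
    (hf : ∀ i, IsAdicCombination (b i) (T i) (L i) (f i) (v i)) :
    |∑ n ∈ Finset.range K, ∏ i, f i (y n i) - K * ∏ i, v i| ≤ C * ∏ i, L i := by
  choose ε h1 h2 h3 using hf
  have e1 : ∑ n ∈ Finset.range K, ∏ i, f i (y n i) - K * ∏ i, v i =
      ∑ e ∈ Fintype.piFinset T, (∏ i, ε i (e i)) *
        (boxCount y K (fun i => ((e i).1 : ℝ) / (b i : ℝ) ^ (e i).2)
          (fun i => (((e i).1 : ℝ) + 1) / (b i : ℝ) ^ (e i).2) -
          K * ∏ i, (1 / (b i : ℝ) ^ (e i).2)) := by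
    simp only [h1, h2, Finset.prod_univ_sum, Finset.prod_mul_distrib, mul_sub,
      Finset.sum_sub_distrib, boxCount, Finset.mul_sum]
    rw [Finset.sum_comm]
    congr 1
    exact Finset.sum_congr rfl fun e _ => by ring
  rw [e1]
  refine (Finset.abs_sum_le_sum_abs _ _).trans ?_
  calc _ ≤ ∑ e ∈ Fintype.piFinset T, (∏ i, |ε i (e i)|) * C := by
        refine Finset.sum_le_sum fun e he => ?_
        rw [abs_mul, Finset.abs_prod]
        exact mul_le_mul_of_nonneg_left (h K (fun i => (e i).1) (fun i => (e i).2)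
          fun i => hT i _ (Fintype.mem_piFinset.1 he i))
          (Finset.prod_nonneg fun i _ => abs_nonneg _)
    _ = C * ∏ i, ∑ e ∈ T i, |ε i e| := by
        rw [← Finset.sum_mul, mul_comm, Finset.prod_univ_sum]
    _ ≤ C * ∏ i, L i := mul_le_mul_of_nonneg_left
        (Finset.prod_le_prod (fun i _ => Finset.sum_nonneg fun e _ => abs_nonneg _)
          fun i _ => h3 i) hC

theorem HasAdicDeviation.abs_boxCount_grid_sub_le {s : ℕ} {y : ℕ → Fin s → ℝ} {b : Fin s → ℕ}
    {C : ℝ} (h : HasAdicDeviation y b C) (hb : ∀ i, 2 ≤ b i) (hC : 0 ≤ C) (K F : ℕ)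
    {u w : Fin s → ℕ} (huw : ∀ i, u i ≤ w i) (hw : ∀ i, w i ≤ b i ^ F) :
    |boxCount y K (fun i => (u i : ℝ) / (b i : ℝ) ^ F) (fun i => (w i : ℝ) / (b i : ℝ) ^ F) -
      K * ∏ i, ((w i : ℝ) / (b i : ℝ) ^ F - (u i : ℝ) / (b i : ℝ) ^ F)| ≤
      C * ∏ i, (2 * (1 + F * (b i : ℝ))) := by
  refine h.abs_sum_prod_sub_le hC K
    (T := fun i => ((Finset.range (b i ^ F)) ×ˢ (Finset.range (F + 1))).filter
      fun e => e.1 < b i ^ e.2) (fun i e he => (Finset.mem_filter.1 he).2)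
    fun i => IsAdicCombination.interval (hb i) (fun d hd a ha => ?_) (huw i) (hw i)
  have : b i ^ d ≤ b i ^ F := Nat.pow_le_pow_right (by have := hb i; omega) hd
  simp only [Finset.mem_filter, Finset.mem_product, Finset.mem_range]
  omega

theorem prod_sub_prod_le {s : ℕ} {x z : Fin s → ℝ} {δ : ℝ} (hz : ∀ i, 0 ≤ z i)
    (hzx : ∀ i, z i ≤ x i) (hx : ∀ i, x i ≤ 1) (hδ : ∀ i, x i - z i ≤ δ) :
    ∏ i, x i - ∏ i, z i ≤ s * δ := by
  induction s with
  | zero => simp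
  | succ s ih =>
    have ih' := ih (x := fun i => x i.succ) (z := fun i => z i.succ) (fun i => hz _)
      (fun i => hzx _) (fun i => hx _) (fun i => hδ _)
    have h1 : ∏ i : Fin s, z i.succ ≤ 1 :=
      Finset.prod_le_one (fun i _ => hz _) fun i _ => (hzx _).trans (hx _)
    have h1' : 0 ≤ ∏ i : Fin s, z i.succ := Finset.prod_nonneg fun i _ => hz _
    have h2 : ∏ i : Fin s, z i.succ ≤ ∏ i : Fin s, x i.succ :=
      Finset.prod_le_prod (fun i _ => hz _) fun i _ => hzx _
    rw [Fin.prod_univ_succ, Fin.prod_univ_succ]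
    push_cast
    have h3 := hx 0
    have h4 := hzx 0
    have h5 := hδ 0
    have h6 := (hz 0).trans (hzx 0)
    nlinarith

/-- Rounding to the grid of mesh b_i^(-F) changes each side by at most 2/b_i^F ≤ 2/K, hence K times
the volume by at most 2s. This is the role of K ≤ 2^F. -/
theorem HasAdicDeviation.abs_boxCount_sub_le {s : ℕ} {y : ℕ → Fin s → ℝ} {b : Fin s → ℕ} {C : ℝ}
    (h : HasAdicDeviation y b C) (hb : ∀ i, 2 ≤ b i) (hC : 0 ≤ C) {K F : ℕ} (hK : K ≤ 2 ^ F)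
    {a c : Fin s → ℝ} (hac : ∀ i, 0 ≤ a i ∧ a i ≤ c i ∧ c i ≤ 1) :
    |boxCount y K a c - K * ∏ i, (c i - a i)| ≤
      C * ∏ i, (2 * (1 + F * (b i : ℝ))) + 2 * s := by
  have hB : ∀ i, (0 : ℝ) < (b i : ℝ) ^ F := fun i =>
    pow_pos (by exact_mod_cast (by have := hb i; omega : 0 < b i)) _
  have hKB : ∀ i, (K : ℝ) ≤ (b i : ℝ) ^ F := fun i => by
    calc (K : ℝ) ≤ 2 ^ F := by exact_mod_cast hK
      _ ≤ (b i : ℝ) ^ F := pow_le_pow_left₀ two_pos.le (by exact_mod_cast hb i) _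
  rcases Nat.eq_zero_or_pos K with rfl | hK0
  · simp only [boxCount, Finset.range_zero, Finset.sum_empty, Nat.cast_zero, zero_mul, sub_zero,
      abs_zero]
    have : 0 ≤ ∏ i, (2 * (1 + (F : ℝ) * (b i : ℝ))) := Finset.prod_nonneg fun i _ => by positivity
    positivity
  have hK0' : (0 : ℝ) < K := by exact_mod_cast hK0
  have hinv : ∀ i, 2 / (b i : ℝ) ^ F ≤ 2 / K := fun i => by
    have := hKB i
    gcongr
  have hslack : ∀ x z : Fin s → ℝ, (∀ i, 0 ≤ z i) → (∀ i, z i ≤ x i) → (∀ i, x i ≤ 1) →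
      (∀ i, x i - z i ≤ 2 / (b i : ℝ) ^ F) → K * ∏ i, x i - K * ∏ i, z i ≤ 2 * s := by
    intro x z h1 h2 h3 h4
    have := prod_sub_prod_le h1 h2 h3 fun i => (h4 i).trans (hinv i)
    rw [← mul_sub]
    calc _ ≤ (K : ℝ) * (s * (2 / K)) := by gcongr
      _ = 2 * s := by field_simp
  have ha0 : ∀ i, 0 ≤ a i * (b i : ℝ) ^ F := fun i => mul_nonneg (hac i).1 (hB i).le
  have hc0 : ∀ i, 0 ≤ c i * (b i : ℝ) ^ F := fun i =>
    mul_nonneg ((hac i).1.trans (hac i).2.1) (hB i).le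
  have hac' : ∀ i, a i * (b i : ℝ) ^ F ≤ c i * (b i : ℝ) ^ F := fun i =>
    mul_le_mul_of_nonneg_right (hac i).2.1 (hB i).le
  have hcB : ∀ i, c i * (b i : ℝ) ^ F ≤ ((b i ^ F : ℕ) : ℝ) := fun i => by
    push_cast
    exact mul_le_of_le_one_left (hB i).le (hac i).2.2
  rw [abs_le]
  constructor
  · -- inner approximation
    set u : Fin s → ℕ := fun i => ⌈a i * (b i : ℝ) ^ F⌉₊ with hu
    -- A side containing no grid point would be rounded to right end < left end; the maximum makes
    -- it empty instead.
    set w : Fin s → ℕ := fun i => max (u i) ⌊c i * (b i : ℝ) ^ F⌋₊ with hw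
    have huB : ∀ i, u i ≤ b i ^ F := fun i => Nat.ceil_le.2 ((hac' i).trans (hcB i))
    have hwB : ∀ i, w i ≤ b i ^ F := fun i =>
      max_le (huB i) (Nat.floor_le_of_le (hcB i))
    have hg := h.abs_boxCount_grid_sub_le hb hC K F (fun i => le_max_left _ _ : ∀ i, u i ≤ w i) hwB
    have hau : ∀ i, a i ≤ (u i : ℝ) / (b i : ℝ) ^ F := fun i => by
      rw [le_div_iff₀ (hB i)]; exact Nat.le_ceil _
    have hle : boxCount y K (fun i => (u i : ℝ) / (b i : ℝ) ^ F)
        (fun i => (w i : ℝ) / (b i : ℝ) ^ F) ≤ boxCount y K a c := by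
      refine Finset.sum_le_sum fun n _ => Finset.prod_le_prod (fun i _ => icoInd_nonneg _ _ _)
        fun i _ => ?_
      rcases le_total (u i) ⌊c i * (b i : ℝ) ^ F⌋₊ with hh | hh
      · refine icoInd_mono (hau i) ?_ _
        rw [div_le_iff₀ (hB i), hw]
        simp only [max_eq_right hh]
        exact Nat.floor_le (hc0 i)
      · have : icoInd ((u i : ℝ) / (b i : ℝ) ^ F) ((w i : ℝ) / (b i : ℝ) ^ F) (y n i) = 0 := by
          simp [hw, max_eq_left hh, icoInd]
        rw [this]
        exact icoInd_nonneg _ _ _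
    have hs := hslack (fun i => max (c i - a i) ((w i : ℝ) / (b i : ℝ) ^ F - (u i : ℝ) / (b i : ℝ) ^ F))
      (fun i => (w i : ℝ) / (b i : ℝ) ^ F - (u i : ℝ) / (b i : ℝ) ^ F)
      (fun i => by
        rw [← sub_div]
        exact div_nonneg (sub_nonneg.2 (by exact_mod_cast le_max_left _ _)) (hB i).le)
      (fun i => le_max_right _ _) ?_ ?_
    · have hp : ∏ i, (c i - a i) ≤
          ∏ i, max (c i - a i) ((w i : ℝ) / (b i : ℝ) ^ F - (u i : ℝ) / (b i : ℝ) ^ F) :=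
        Finset.prod_le_prod (fun i _ => sub_nonneg.2 (hac i).2.1) fun i _ => le_max_left _ _
      have := mul_le_mul_of_nonneg_left hp hK0'.le
      have := (abs_le.1 hg).1
      linarith
    · intro i
      refine max_le (by linarith [(hac i).1, (hac i).2.2]) ?_
      have h1 : (w i : ℝ) / (b i : ℝ) ^ F ≤ 1 := by
        rw [div_le_one (hB i)]; exact_mod_cast hwB i
      have h2 : 0 ≤ (u i : ℝ) / (b i : ℝ) ^ F := by have := hB i; positivity
      linarith
    · intro i
      rcases max_choice (c i - a i) ((w i : ℝ) / (b i : ℝ) ^ F - (u i : ℝ) / (b i : ℝ) ^ F)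
        with hm | hm <;> rw [hm]
      · rw [← sub_div, sub_le_iff_le_add, ← add_div, le_div_iff₀ (hB i), sub_mul]
        have h1 := (Nat.ceil_lt_add_one (ha0 i)).le
        have h2 := (Nat.lt_floor_add_one (c i * (b i : ℝ) ^ F)).le
        have h3 : (⌊c i * (b i : ℝ) ^ F⌋₊ : ℝ) ≤ w i :=
          Nat.cast_le.2 (le_max_right _ _)
        have h4 : (u i : ℝ) = (⌈a i * (b i : ℝ) ^ F⌉₊ : ℝ) := rfl
        linarith
      · rw [sub_self]; have := hB i; positivity
  · -- outer approximation
    set u : Fin s → ℕ := fun i => ⌊a i * (b i : ℝ) ^ F⌋₊ with hu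
    set w : Fin s → ℕ := fun i => ⌈c i * (b i : ℝ) ^ F⌉₊ with hw
    have hwB : ∀ i, w i ≤ b i ^ F := fun i => Nat.ceil_le.2 (hcB i)
    have huw : ∀ i, u i ≤ w i := fun i => (Nat.floor_le_floor (hac' i)).trans (Nat.floor_le_ceil _)
    have hg := h.abs_boxCount_grid_sub_le hb hC K F huw hwB
    have hua : ∀ i, (u i : ℝ) / (b i : ℝ) ^ F ≤ a i := fun i => by
      rw [div_le_iff₀ (hB i)]; exact Nat.floor_le (ha0 i)
    have hcw : ∀ i, c i ≤ (w i : ℝ) / (b i : ℝ) ^ F := fun i => by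
      rw [le_div_iff₀ (hB i)]; exact Nat.le_ceil _
    have hle := boxCount_mono y K hua hcw
    have hs := hslack (fun i => (w i : ℝ) / (b i : ℝ) ^ F - (u i : ℝ) / (b i : ℝ) ^ F)
      (fun i => c i - a i) (fun i => sub_nonneg.2 (hac i).2.1)
      (fun i => sub_le_sub (hcw i) (hua i)) ?_ ?_
    · have := (abs_le.1 hg).2
      linarith
    · intro i
      have h1 : (w i : ℝ) / (b i : ℝ) ^ F ≤ 1 := by
        rw [div_le_one (hB i)]; exact_mod_cast hwB i
      have h2 : 0 ≤ (u i : ℝ) / (b i : ℝ) ^ F := by have := hB i; positivity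
      linarith
    · intro i
      rw [← sub_div, sub_le_iff_le_add, div_le_iff₀ (hB i), add_mul, div_mul_cancel₀ _ (hB i).ne',
        sub_mul]
      have h1 := (Nat.ceil_lt_add_one (hc0 i)).le
      have h2 := (Nat.lt_floor_add_one (a i * (b i : ℝ) ^ F)).le
      simp only [hu, hw]
      linarith

/-! ### Adic deviation of (t,s)-sequences and of Halton sequences. -/

/-- Complete blocks contribute no error, and on the incomplete one both the actual and the expected
sum lie in [0, A]. -/
theorem abs_sum_range_sub_le_of_block_sum_eq {g : ℕ → ℝ} (hg : ∀ n, 0 ≤ g n) {M : ℕ} (hM : 0 < M)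
    {A : ℝ} (hA : ∀ k, ∑ j ∈ Finset.range M, g (M * k + j) = A) (K : ℕ) :
    |∑ n ∈ Finset.range K, g n - K * (A / M)| ≤ A := by
  have hM' : (0 : ℝ) < M := by exact_mod_cast hM
  have h1 : ∑ n ∈ Finset.range K, g n =
      (K / M : ℕ) * A + ∑ j ∈ Finset.range (K % M), g (M * (K / M) + j) := by
    conv_lhs => rw [← Nat.div_add_mod K M]
    rw [Finset.sum_range_add, sum_range_mul_eq]
    simp [hA]
  have h2 : 0 ≤ ∑ j ∈ Finset.range (K % M), g (M * (K / M) + j) :=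
    Finset.sum_nonneg fun _ _ => hg _
  have h3 : ∑ j ∈ Finset.range (K % M), g (M * (K / M) + j) ≤ A := by
    rw [← hA (K / M)]
    exact Finset.sum_le_sum_of_subset_of_nonneg
      (Finset.range_mono (Nat.mod_lt K hM).le) fun _ _ _ => hg _
  have hA0 := h2.trans h3
  have h4 : (K : ℝ) * (A / M) = (K / M : ℕ) * A + (K % M : ℕ) * (A / M) := by
    have : (K : ℝ) = M * (K / M : ℕ) + (K % M : ℕ) := by exact_mod_cast (Nat.div_add_mod K M).symm
    rw [this]
    field_simp
  have h5 : ((K % M : ℕ) : ℝ) * (A / M) ≤ A := by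
    have : ((K % M : ℕ) : ℝ) ≤ M := by exact_mod_cast (Nat.mod_lt K hM).le
    calc _ ≤ (M : ℝ) * (A / M) := by gcongr
      _ = A := by field_simp
  have h6 : 0 ≤ ((K % M : ℕ) : ℝ) * (A / M) := by positivity
  rw [h1, h4, abs_le]
  constructor <;> linarith

theorem prod_icoInd_nonneg {s : ℕ} (a c z : Fin s → ℝ) : 0 ≤ ∏ i, icoInd (a i) (c i) (z i) :=
  Finset.prod_nonneg fun _ _ => icoInd_nonneg _ _ _

theorem IsTSSequence.hasAdicDeviation {b t s : ℕ} (hb : 2 ≤ b) {x : ℕ → Fin s → ℝ}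
    (hx : IsTSSequence b t s x) : HasAdicDeviation x (fun _ => b) ((b : ℝ) ^ t) := by
  classical
  intro K a d ha
  -- With this m the box has volume b^(t-m), so every block of length b^m meets it exactly b^t
  -- times.
  set m := ∑ i, d i + t with hm
  have hb' : (0 : ℝ) < b := by exact_mod_cast (by omega : 0 < b)
  beta_reduce at ha ⊢
  have h := abs_sum_range_sub_le_of_block_sum_eq
    (g := fun n => ∏ i, icoInd ((a i : ℝ) / (b : ℝ) ^ d i) (((a i : ℝ) + 1) / (b : ℝ) ^ d i) (x n i))
    (fun n => prod_icoInd_nonneg _ _ _) (M := b ^ m) (by positivity) (A := (b : ℝ) ^ t)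
    (fun k => ?_) K
  · convert h using 4
    · rfl
    · rw [Finset.prod_div_distrib, Finset.prod_pow_eq_pow_sum, Finset.prod_const_one, hm]
      push_cast
      rw [pow_add]
      field_simp
  · have h1 := (hx k m (by omega)).2.2 a d ha (by omega)
    have h2 := boxCount_eq_card (fun j => x (k * b ^ m + j)) (b ^ m)
      (fun i => (a i : ℝ) / (b : ℝ) ^ d i) (fun i => ((a i : ℝ) + 1) / (b : ℝ) ^ d i)
    rw [mul_comm (b ^ m) k]
    refine h2.trans ?_
    rw [← Nat.cast_pow, ← h1]
    congr 1
    rw [Finset.card_filter, Finset.card_filter, Finset.sum_range]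
    rfl

theorem radicalInverse_eq {b : ℕ} (hb : 2 ≤ b) (n : ℕ) :
    radicalInverse b n = ((n % b : ℕ) + radicalInverse b (n / b)) / b := by
  have hb' : (0 : ℝ) < b := by exact_mod_cast (by omega : 0 < b)
  rcases Nat.eq_zero_or_pos n with rfl | hn
  · simp [radicalInverse]
  · rw [radicalInverse, Nat.digits_def' (by omega) hn, List.length_cons, Finset.sum_range_succ',
      radicalInverse, add_div, add_comm, Finset.sum_div]
    congr 1
    · simp
    · refine Finset.sum_congr rfl fun i _ => ?_
      rw [List.getD_cons_succ, pow_succ _ (i + 1)]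
      field_simp

theorem radicalInverse_mem_Ico {b : ℕ} (hb : 2 ≤ b) (n : ℕ) :
    radicalInverse b n ∈ Set.Ico (0 : ℝ) 1 := by
  have hb' : (0 : ℝ) < b := by exact_mod_cast (by omega : 0 < b)
  induction n using Nat.strong_induction_on with
  | _ n ih =>
    rcases Nat.eq_zero_or_pos n with rfl | hn
    · simp [radicalInverse]
    · obtain ⟨h1, h2⟩ := ih (n / b) (Nat.div_lt_self hn (by omega))
      have h3 : ((n % b : ℕ) : ℝ) + 1 ≤ b := by exact_mod_cast Nat.mod_lt n (by omega)
      rw [radicalInverse_eq hb]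
      refine ⟨by positivity, ?_⟩
      rw [div_lt_one hb']
      linarith

/-- Prescribing the first d fractional digits of the radical inverse prescribes the d lowest digits
of n. -/
theorem exists_radicalInverse_mem_Ico_iff {b : ℕ} (hb : 2 ≤ b) (d : ℕ) {a : ℕ} (ha : a < b ^ d) :
    ∃ r, ∀ n, radicalInverse b n ∈ Set.Ico ((a : ℝ) / (b : ℝ) ^ d) (((a : ℝ) + 1) / (b : ℝ) ^ d) ↔
      n ≡ r [MOD b ^ d] := by
  have hb' : (0 : ℝ) < b := by exact_mod_cast (by omega : 0 < b)
  induction d generalizing a with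
  | zero =>
    have : a = 0 := by simpa using ha
    subst this
    exact ⟨0, fun n => by simpa [Nat.modEq_one] using radicalInverse_mem_Ico hb n⟩
  | succ d ih =>
    have hbd : 0 < b ^ d := by positivity
    obtain ⟨r, hr⟩ := ih (Nat.mod_lt a hbd)
    -- The leading digit of a is the lowest digit of n; the remaining digits of a determine n / b
    -- modulo b^d.
    refine ⟨a / b ^ d + b * r, fun n => ?_⟩
    have ha0 : a / b ^ d < b := Nat.div_lt_of_lt_mul (by rwa [pow_succ] at ha)
    have hnm : n % b < b := Nat.mod_lt n (by omega)
    have h1 : n ≡ a / b ^ d + b * r [MOD b ^ (d + 1)] ↔ n % b = a / b ^ d ∧ n / b ≡ r [MOD b ^ d] := by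
      constructor
      · intro h
        have h2 : n % b = a / b ^ d := by
          have := h.of_dvd (Dvd.intro_left (b ^ d) rfl : b ∣ b ^ (d + 1))
          unfold Nat.ModEq at this
          rwa [Nat.add_mul_mod_self_left, Nat.mod_eq_of_lt ha0] at this
        refine ⟨h2, ?_⟩
        conv at h => lhs; rw [← Nat.mod_add_div n b, h2]
        have h3 := Nat.ModEq.add_left_cancel' _ h
        rw [pow_succ'] at h3
        exact Nat.ModEq.mul_left_cancel' (by omega) h3
      · rintro ⟨h2, h3⟩
        conv => lhs; rw [← Nat.mod_add_div n b, h2]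
        rw [pow_succ']
        exact (h3.mul_left' b).add_left _
    rw [h1, ← hr]
    obtain ⟨p1, p2⟩ := radicalInverse_mem_Ico hb (n / b)
    set z := radicalInverse b (n / b) with hz
    have hB : (0 : ℝ) < (b : ℝ) ^ d := by positivity
    have ea : (a : ℝ) = (b : ℝ) ^ d * (a / b ^ d : ℕ) + (a % b ^ d : ℕ) := by
      exact_mod_cast (Nat.div_add_mod a (b ^ d)).symm
    have hmod : ((a % b ^ d : ℕ) : ℝ) + 1 ≤ (b : ℝ) ^ d := by
      exact_mod_cast Nat.mod_lt a hbd
    have hmod0 : (0 : ℝ) ≤ ((a % b ^ d : ℕ) : ℝ) := Nat.cast_nonneg _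
    rw [radicalInverse_eq hb n, ← hz, Set.mem_Ico, Set.mem_Ico, pow_succ, div_le_div_iff₀ (by positivity) hb',
      div_lt_div_iff₀ hb' (by positivity), div_le_iff₀ hB, lt_div_iff₀ hB,
      ← mul_assoc, mul_le_mul_iff_left₀ hb', mul_lt_mul_iff_left₀ hb', ea]
    constructor
    · rintro ⟨h2, h3⟩
      have h4 : n % b = a / b ^ d := by
        apply le_antisymm
        · by_contra! hlt
          have : ((a / b ^ d : ℕ) : ℝ) + 1 ≤ (n % b : ℕ) := by exact_mod_cast hlt
          nlinarith
        · by_contra! hlt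
          have : ((n % b : ℕ) : ℝ) + 1 ≤ (a / b ^ d : ℕ) := by exact_mod_cast hlt
          nlinarith
      rw [h4] at h2 h3
      exact ⟨h4, by linarith, by linarith⟩
    · rintro ⟨h2, h3, h4⟩
      rw [h2]
      constructor <;> linarith

theorem abs_count_modEq_sub_le {M : ℕ} (hM : 0 < M) (r K : ℕ) :
    |((K.count (· ≡ r [MOD M]) : ℕ) : ℝ) - K * (1 / M)| ≤ 1 := by
  have hM' : (0 : ℝ) < M := by exact_mod_cast hM
  have h4 : (K : ℝ) * (1 / M) = (K / M : ℕ) + (K % M : ℕ) / (M : ℝ) := by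
    have : (K : ℝ) = M * (K / M : ℕ) + (K % M : ℕ) := by exact_mod_cast (Nat.div_add_mod K M).symm
    rw [this]
    field_simp
  have h5 : ((K % M : ℕ) : ℝ) / M ≤ 1 := by
    rw [div_le_one hM']
    exact_mod_cast (Nat.mod_lt K hM).le
  have h6 : 0 ≤ ((K % M : ℕ) : ℝ) / M := by positivity
  rw [Nat.count_modEq_card _ hM, h4, abs_le]
  push_cast
  split_ifs <;> constructor <;> linarith

/-- By the Chinese remainder theorem an adic box corresponds to one residue class modulo ∏
b_i^(d_i). -/
theorem hasAdicDeviation_haltonSeq {s : ℕ} {b : Fin s → ℕ} (hb : ∀ i, 2 ≤ b i)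
    (hco : Pairwise fun i j => Nat.Coprime (b i) (b j)) : HasAdicDeviation (haltonSeq b) b 1 := by
  classical
  intro K a d ha
  choose r hr using fun i => exists_radicalInverse_mem_Ico_iff (hb i) (d i) (ha i)
  have hco' : Pairwise (Function.onFun Nat.Coprime fun i => b i ^ d i) := fun i j hij =>
    (hco hij).pow _ _
  have hne : ∀ i, b i ^ d i ≠ 0 := fun i => by have := hb i; positivity
  obtain ⟨v, hv⟩ := Nat.chineseRemainderOfFinset r (fun i => b i ^ d i) Finset.univ
    (fun i _ => hne i) (fun i _ j _ hij => hco' hij)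
  have hiff : ∀ n, (∀ i, n ≡ r i [MOD b i ^ d i]) ↔ n ≡ v [MOD ∏ i, b i ^ d i] := fun n => by
    have h1 : (∏ i, b i ^ d i) = ((List.finRange s).map fun i => b i ^ d i).prod := by
      rw [← List.ofFn_eq_map, List.prod_ofFn]
    rw [h1, Nat.modEq_list_map_prod_iff]
    · exact ⟨fun h i _ => (h i).trans (hv i (Finset.mem_univ i)).symm,
        fun h i => (h i (List.mem_finRange i)).trans (hv i (Finset.mem_univ i))⟩
    · exact (List.nodup_finRange s).pairwise_of_forall_ne fun i _ j _ hij => hco' hij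
  have hcard := abs_count_modEq_sub_le
    (Nat.pos_of_ne_zero (Finset.prod_ne_zero_iff.2 fun i (_ : i ∈ Finset.univ) => hne i)) v K
  convert hcard using 3
  · rw [boxCount_eq_card, Nat.count_eq_card_filter_range]
    congr 2
    refine Finset.filter_congr fun n _ => ?_
    rw [← hiff]
    simp only [box, Set.mem_univ_pi, ← hr]
    rfl
  · push_cast
    rw [Finset.prod_div_distrib, Finset.prod_const_one]

/-! ### Concentration of the sum of digits and the lower bound. -/

theorem sum_range_two_mul_sub (q : ℕ) :
    ∑ i ∈ Finset.range q, (2 * (i : ℝ) - ((q : ℝ) - 1)) = 0 := by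
  have h : ∀ n : ℕ, ∑ i ∈ Finset.range n, (2 * (i : ℝ)) = n * ((n : ℝ) - 1) := fun n => by
    induction n with
    | zero => simp
    | succ n ih => rw [Finset.sum_range_succ, ih]; push_cast; ring
  rw [Finset.sum_sub_distrib, h]
  simp
  ring

/-- A digit has mean (q-1)/2, so the cross term vanishes and each new digit adds at most q² to the
mean square. Doubling avoids halves. -/
theorem sum_sq_sumOfDigits_sub_le {q : ℕ} (hq : 2 ≤ q) (m : ℕ) :
    ∑ n ∈ Finset.range (q ^ m), (2 * (sumOfDigits q n : ℝ) - m * ((q : ℝ) - 1)) ^ 2 ≤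
      m * (q : ℝ) ^ 2 * (q : ℝ) ^ m := by
  have hq' : (2 : ℝ) ≤ q := by exact_mod_cast hq
  induction m with
  | zero => simp [sumOfDigits]
  | succ m ih =>
    rw [pow_succ', sum_range_mul_eq]
    have key : ∀ n ∈ Finset.range (q ^ m), ∑ i ∈ Finset.range q,
        (2 * (sumOfDigits q (q * n + i) : ℝ) - ((m + 1 : ℕ) : ℝ) * ((q : ℝ) - 1)) ^ 2 ≤
        q * (2 * (sumOfDigits q n : ℝ) - m * ((q : ℝ) - 1)) ^ 2 + (q : ℝ) ^ 3 := fun n _ => by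
      set u := 2 * (sumOfDigits q n : ℝ) - m * ((q : ℝ) - 1) with hu
      have e : ∀ i ∈ Finset.range q,
          (2 * (sumOfDigits q (q * n + i) : ℝ) - ((m + 1 : ℕ) : ℝ) * ((q : ℝ) - 1)) ^ 2 ≤
          u ^ 2 + 2 * u * (2 * (i : ℝ) - ((q : ℝ) - 1)) + (q : ℝ) ^ 2 := fun i hi => by
        have hi' := Finset.mem_range.1 hi
        have h1 : (i : ℝ) + 1 ≤ q := by exact_mod_cast hi'
        have h0 : (0 : ℝ) ≤ i := Nat.cast_nonneg i
        rw [sumOfDigits_mul_add hq n hi']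
        push_cast
        have h2 : (2 * (i : ℝ) - ((q : ℝ) - 1)) ^ 2 ≤ (q : ℝ) ^ 2 :=
          sq_le_sq' (by linarith) (by linarith)
        rw [hu]
        nlinarith
      refine (Finset.sum_le_sum e).trans (le_of_eq ?_)
      rw [Finset.sum_add_distrib, Finset.sum_add_distrib, ← Finset.mul_sum, sum_range_two_mul_sub]
      simp
      ring
    refine (Finset.sum_le_sum key).trans ?_
    rw [Finset.sum_add_distrib, ← Finset.mul_sum]
    have := mul_le_mul_of_nonneg_left ih (by positivity : (0 : ℝ) ≤ q)
    simp only [Finset.sum_const, Finset.card_range, nsmul_eq_mul]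
    push_cast
    calc _ ≤ (q : ℝ) * (m * (q : ℝ) ^ 2 * (q : ℝ) ^ m) + (q : ℝ) ^ m * (q : ℝ) ^ 3 := by gcongr
      _ = _ := by ring

theorem card_Icc_ceil_floor_le {μ R : ℝ} (h : 0 ≤ μ + R) (hR : 0 ≤ R) :
    ((Finset.Icc ⌈(μ - R) / 2⌉₊ ⌊(μ + R) / 2⌋₊).card : ℝ) ≤ R + 1 := by
  rw [Nat.card_Icc]
  have h1 := Nat.floor_le (a := (μ + R) / 2) (by linarith)
  have h2 := Nat.le_ceil ((μ - R) / 2)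
  rcases le_total ⌈(μ - R) / 2⌉₊ (⌊(μ + R) / 2⌋₊ + 1) with h3 | h3
  · rw [Nat.cast_sub h3]
    push_cast
    linarith
  · rw [Nat.sub_eq_zero_of_le h3]
    push_cast
    linarith

/-- Some value of the sum of digits is attained exceptionally often. -/
theorem exists_le_card_sumOfDigits_eq {q : ℕ} (hq : 2 ≤ q) (m : ℕ) :
    ∃ k, (q : ℝ) ^ m / (4 * q * √(m + 1)) ≤
      (((Finset.range (q ^ m)).filter fun n => sumOfDigits q n = k).card : ℝ) := by
  have hq' : (2 : ℝ) ≤ q := by exact_mod_cast hq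
  set μ : ℝ := m * ((q : ℝ) - 1) with hμ
  -- Chebyshev then leaves at most 4/9 of the n outside the window, while the at most R + 1 values
  -- inside it still number at most 2q√(m+1).
  set R : ℝ := 3 / 2 * q * √(m + 1) with hR
  have hs1 : 1 ≤ √((m : ℝ) + 1) := Real.one_le_sqrt.2 (by linarith [Nat.cast_nonneg (α := ℝ) m])
  have hs2 : √((m : ℝ) + 1) ^ 2 = m + 1 := Real.sq_sqrt (by positivity)
  have hR0 : 0 < R := by positivity
  have hμ0 : 0 ≤ μ := mul_nonneg (Nat.cast_nonneg _) (by linarith)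
  have hQ : (0 : ℝ) < (q : ℝ) ^ m := by positivity
  set G := (Finset.range (q ^ m)).filter fun n => |2 * (sumOfDigits q n : ℝ) - μ| ≤ R with hG
  set W := Finset.Icc ⌈(μ - R) / 2⌉₊ ⌊(μ + R) / 2⌋₊ with hW
  have hGcard : (q : ℝ) ^ m / 2 ≤ (G.card : ℝ) := by
    set B := (Finset.range (q ^ m)).filter fun n => ¬ |2 * (sumOfDigits q n : ℝ) - μ| ≤ R with hB
    have h1 : (G.card : ℝ) + B.card = (q : ℝ) ^ m := by
      have := Finset.card_filter_add_card_filter_not (s := Finset.range (q ^ m))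
        (fun n => |2 * (sumOfDigits q n : ℝ) - μ| ≤ R)
      rw [Finset.card_range] at this
      rw [hG, hB, ← Nat.cast_add, this, Nat.cast_pow]
    have h2 : (B.card : ℝ) * R ^ 2 ≤ m * (q : ℝ) ^ 2 * (q : ℝ) ^ m := by
      refine le_trans ?_ (sum_sq_sumOfDigits_sub_le hq m)
      rw [← nsmul_eq_mul, ← Finset.sum_const]
      refine le_trans (Finset.sum_le_sum fun n hn => ?_)
        (Finset.sum_le_sum_of_subset_of_nonneg (Finset.filter_subset _ _) fun n _ _ => sq_nonneg _)
      have := (Finset.mem_filter.1 hn).2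
      rw [← sq_abs (2 * (sumOfDigits q n : ℝ) - m * ((q : ℝ) - 1))]
      exact pow_le_pow_left₀ hR0.le (not_le.1 this).le 2
    have h3 : R ^ 2 = 9 / 4 * (q : ℝ) ^ 2 * (m + 1) := by
      rw [hR, mul_pow, mul_pow, hs2]; ring
    have h4 : (B.card : ℝ) * (9 / 4) ≤ (q : ℝ) ^ m := by
      have h5 : (B.card : ℝ) * (9 / 4) * ((q : ℝ) ^ 2 * (m + 1)) ≤
          (q : ℝ) ^ m * ((q : ℝ) ^ 2 * (m + 1)) := by
        rw [h3] at h2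
        have : 0 ≤ (q : ℝ) ^ 2 * (q : ℝ) ^ m := by positivity
        linarith
      exact le_of_mul_le_mul_right h5 (by positivity)
    linarith
  have hmaps : ∀ n ∈ G, sumOfDigits q n ∈ W := fun n hn => by
    have h := abs_le.1 (Finset.mem_filter.1 hn).2
    rw [hW, Finset.mem_Icc]
    exact ⟨Nat.ceil_le.2 (by linarith), Nat.le_floor (by linarith)⟩
  have hWcard : (W.card : ℝ) ≤ 2 * q * √(m + 1) := by
    refine (card_Icc_ceil_floor_le (by linarith) hR0.le).trans ?_
    rw [hR]
    nlinarith
  have hWne : W.Nonempty := by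
    have : 0 < G.card := by
      have : (0 : ℝ) < G.card := lt_of_lt_of_le (by positivity) hGcard
      exact_mod_cast this
    obtain ⟨n, hn⟩ := Finset.card_pos.1 this
    exact ⟨_, hmaps n hn⟩
  obtain ⟨k, _, hk⟩ := Finset.exists_le_card_fiber_of_nsmul_le_card_of_maps_to hmaps hWne
    (b := (q : ℝ) ^ m / (4 * q * √(m + 1))) (by
      rw [nsmul_eq_mul]
      refine le_trans (mul_le_mul_of_nonneg_right hWcard (by positivity)) (le_trans (le_of_eq ?_) hGcard)
      field_simp
      norm_num)
  refine ⟨k, hk.trans ?_⟩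
  exact_mod_cast Finset.card_le_card (Finset.filter_subset_filter _ (Finset.filter_subset _ _))

theorem abs_localDiscrepancy_le_one {s : ℕ} (y : ℕ → Fin s → ℝ) (N : ℕ) {a c : Fin s → ℝ}
    (hac : ∀ i, 0 ≤ a i ∧ a i ≤ c i ∧ c i ≤ 1) : |localDiscrepancy y N a c| ≤ 1 := by
  classical
  have h1 : ∏ i, (c i - a i) ≤ 1 := Finset.prod_le_one (fun i _ => sub_nonneg.2 (hac i).2.1)
    fun i _ => by linarith [(hac i).1, (hac i).2.2]
  have h2 : 0 ≤ ∏ i, (c i - a i) := Finset.prod_nonneg fun i _ => sub_nonneg.2 (hac i).2.1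
  have h3 : (((Finset.range N).filter fun n => y n ∈ box a c).card : ℝ) / N ≤ 1 := by
    refine div_le_one_of_le₀ ?_ (Nat.cast_nonneg _)
    exact_mod_cast (Finset.card_filter_le _ _).trans (Finset.card_range N).le
  have h4 : 0 ≤ (((Finset.range N).filter fun n => y n ∈ box a c).card : ℝ) / N := by positivity
  unfold localDiscrepancy
  rw [abs_le]
  constructor <;> linarith

theorem abs_localDiscrepancy_le_discrepancy {s : ℕ} (y : ℕ → Fin s → ℝ) (N : ℕ) {a c : Fin s → ℝ}
    (hac : ∀ i, 0 ≤ a i ∧ a i ≤ c i ∧ c i ≤ 1) :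
    |localDiscrepancy y N a c| ≤ discrepancy y N := by
  refine le_csSup ⟨1, ?_⟩ ⟨a, c, hac, rfl⟩
  rintro _ ⟨a, c, hac, rfl⟩
  exact abs_localDiscrepancy_le_one y N hac

theorem discrepancy_le {s : ℕ} {y : ℕ → Fin s → ℝ} {N : ℕ} {B : ℝ}
    (h : ∀ a c : Fin s → ℝ, (∀ i, 0 ≤ a i ∧ a i ≤ c i ∧ c i ≤ 1) → |localDiscrepancy y N a c| ≤ B) :
    discrepancy y N ≤ B := by
  refine csSup_le ⟨_, 0, 0, fun _ => ⟨le_rfl, le_rfl, zero_le_one⟩, rfl⟩ ?_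
  rintro _ ⟨a, c, hac, rfl⟩
  exact h a c hac

/-- A box with lower corner x_k and sides shrinking to 0 always contains x_k, while its volume tends
to 0 because s ≥ 1. -/
theorem card_fiber_div_le_discrepancy {s : ℕ} (hs : 1 ≤ s) {x : ℕ → Fin s → ℝ}
    (hx : ∀ n i, x n i ∈ Set.Ico (0 : ℝ) 1) (g : ℕ → ℕ) (N k : ℕ) :
    (((Finset.range N).filter fun n => g n = k).card : ℝ) / N ≤ discrepancy (fun n => x (g n)) N := by
  classical
  refine le_of_forall_pos_le_add fun ε hε => ?_
  set δ := min ε 1 with hδ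
  have hδ0 : 0 < δ := lt_min hε one_pos
  have hδ1 : δ ≤ 1 := min_le_right _ _
  have hx0 := fun i => (hx k i).1
  have hx1 := fun i => (hx k i).2
  have hac : ∀ i, 0 ≤ x k i ∧ x k i ≤ x k i + δ * (1 - x k i) ∧ x k i + δ * (1 - x k i) ≤ 1 :=
    fun i => by
      have := hx0 i
      have := hx1 i
      refine ⟨hx0 i, by nlinarith, by nlinarith⟩
  have h := (le_abs_self _).trans (abs_localDiscrepancy_le_discrepancy (fun n => x (g n)) N hac)
  have hvol : ∏ i, (x k i + δ * (1 - x k i) - x k i) ≤ δ := by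
    calc _ ≤ ∏ _i : Fin s, δ := Finset.prod_le_prod
          (fun i _ => sub_nonneg.2 (hac i).2.1) fun i _ => by nlinarith [hx0 i]
      _ = δ ^ s := by simp
      _ ≤ δ := pow_le_of_le_one hδ0.le hδ1 (by omega)
  have hcard : (((Finset.range N).filter fun n => g n = k).card : ℝ) / N ≤
      (((Finset.range N).filter fun n => x (g n) ∈
        box (x k) (fun i => x k i + δ * (1 - x k i))).card : ℝ) / N := by
    gcongr with n hn
    rintro rfl
    intro i _
    have := hx1 i
    exact ⟨le_rfl, by nlinarith⟩
  unfold localDiscrepancy at h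
  have := min_le_left ε 1
  linarith

theorem log_add_one_le_four_mul_log {q N : ℕ} (hq : 2 ≤ q) (hN : 3 ≤ N) :
    ((Nat.log q N : ℕ) : ℝ) + 1 ≤ 4 * Real.log N := by
  have h3 : 1 < Real.log N := by
    have h1 : Real.log 3 ≤ Real.log N := Real.log_le_log (by norm_num) (by exact_mod_cast hN)
    have : 1 < Real.log 3 := by
      rw [Real.lt_log_iff_exp_lt (by norm_num)]
      exact Real.exp_one_lt_d9.trans (by norm_num)
    linarith
  have h4 : (Nat.log q N : ℝ) * Real.log 2 ≤ Real.log N := by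
    rw [← Real.log_pow]
    refine Real.log_le_log (by positivity) ?_
    calc (2 : ℝ) ^ Nat.log q N ≤ (q : ℝ) ^ Nat.log q N :=
          pow_le_pow_left₀ two_pos.le (by exact_mod_cast hq) _
      _ ≤ N := by exact_mod_cast Nat.pow_log_le_self q (by omega)
  have h5 := Real.log_two_gt_d9
  nlinarith [Nat.cast_nonneg (α := ℝ) (Nat.log q N)]

theorem le_discrepancy_comp_sumOfDigits {q : ℕ} (hq : 2 ≤ q) {s : ℕ} (hs : 1 ≤ s)
    {x : ℕ → Fin s → ℝ} (hx : ∀ n i, x n i ∈ Set.Ico (0 : ℝ) 1) {N : ℕ} (hN : 3 ≤ N) :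
    1 / (8 * (q : ℝ) ^ 2) / √(Real.log N) ≤ discrepancy (fun n => x (sumOfDigits q n)) N := by
  have hq' : (2 : ℝ) ≤ q := by exact_mod_cast hq
  set m := Nat.log q N with hm
  obtain ⟨k, hk⟩ := exists_le_card_sumOfDigits_eq hq m
  refine le_trans ?_ (card_fiber_div_le_discrepancy hs hx (sumOfDigits q) N k)
  have hNm : q ^ m ≤ N := Nat.pow_log_le_self q (by omega)
  have hNm' : (N : ℝ) ≤ (q : ℝ) ^ (m + 1) := by
    exact_mod_cast (Nat.lt_pow_succ_log_self (by omega) N).le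
  have hN0 : (0 : ℝ) < N := by exact_mod_cast (by omega : 0 < N)
  have hk' : (q : ℝ) ^ m / (4 * q * √(m + 1)) ≤
      (((Finset.range N).filter fun n => sumOfDigits q n = k).card : ℝ) := by
    refine hk.trans ?_
    exact_mod_cast Finset.card_le_card (Finset.filter_subset_filter _ (Finset.range_mono hNm))
  have hsq : √((m : ℝ) + 1) ≤ 2 * √(Real.log N) := by
    have h := log_add_one_le_four_mul_log hq hN
    have hl : 0 ≤ Real.log N := Real.log_natCast_nonneg N
    rw [Real.sqrt_le_left (by positivity), mul_pow, Real.sq_sqrt hl]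
    linarith
  have hs0 : 0 < √((m : ℝ) + 1) := by positivity
  calc _ = 1 / (4 * (q : ℝ) ^ 2 * (2 * √(Real.log N))) := by rw [div_div]; ring_nf
    _ ≤ 1 / (4 * (q : ℝ) ^ 2 * √(m + 1)) := by gcongr
    _ = (q : ℝ) ^ m / (4 * q * √(m + 1)) / (q : ℝ) ^ (m + 1) := by
        field_simp; ring
    _ ≤ (q : ℝ) ^ m / (4 * q * √(m + 1)) / N := by gcongr
    _ ≤ _ := by gcongr

/-! ### The upper bound and conclusion. -/

theorem sumOfDigits_le {q : ℕ} (hq : 2 ≤ q) {m n : ℕ} (hn : n < q ^ m) :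
    sumOfDigits q n ≤ q * m := by
  induction m generalizing n with
  | zero =>
    have : n = 0 := by simpa using hn
    simp [this, sumOfDigits]
  | succ m ih =>
    have hr : n % q < q := Nat.mod_lt _ (by omega)
    have h := ih (n := n / q) (Nat.div_lt_of_lt_mul (by rwa [pow_succ'] at hn))
    rw [← Nat.div_add_mod n q, sumOfDigits_mul_add hq _ hr, Nat.mul_succ]
    omega

theorem HasAdicDeviation.abs_localDiscrepancy_comp_sumOfDigits_le {q : ℕ} (hq : 2 ≤ q) {s : ℕ}
    {x : ℕ → Fin s → ℝ} {b : Fin s → ℕ} {C : ℝ} (h : HasAdicDeviation x b C) (hb : ∀ i, 2 ≤ b i)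
    (hC : 0 ≤ C) {m N F : ℕ} (hN0 : 0 < N) (hN : N < q ^ m) (hN' : q ^ m ≤ q * N)
    (hF : q * m + 1 ≤ 2 ^ F) {a c : Fin s → ℝ} (hac : ∀ i, 0 ≤ a i ∧ a i ≤ c i ∧ c i ≤ 1) :
    |localDiscrepancy (fun n => x (sumOfDigits q n)) N a c| ≤
      6 * (q : ℝ) ^ 3 / √(m + 1) * (C * ∏ i, (2 * (1 + F * (b i : ℝ))) + 2 * s) := by
  set E := C * ∏ i, (2 * (1 + F * (b i : ℝ))) + 2 * s with hE
  have hE0 : 0 ≤ E := by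
    have : 0 ≤ ∏ i, (2 * (1 + (F : ℝ) * (b i : ℝ))) := Finset.prod_nonneg fun i _ => by positivity
    positivity
  set V := ∏ i, (c i - a i) with hV
  let S : ℕ → ℝ := fun k => boxCount x k a c - k * V
  -- The shift estimate needs a bound at every index, so S is frozen beyond 2^F. Since s_q(n) + 1 ≤
  -- qm + 1 ≤ 2^F, the sum does not notice.
  have hS : ∀ k, |S (min k (2 ^ F))| ≤ E := fun k =>
    h.abs_boxCount_sub_le hb hC (min_le_right _ _) hac
  have hsum := abs_sum_sub_shift_sumOfDigits_le hq hN hE0 hS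
  have hN0' : (0 : ℝ) < N := by exact_mod_cast hN0
  have e : ∑ n ∈ Finset.range N,
      (S (min (sumOfDigits q n + 1) (2 ^ F)) - S (min (sumOfDigits q n) (2 ^ F))) =
      N * localDiscrepancy (fun n => x (sumOfDigits q n)) N a c := by
    rw [localDiscrepancy, mul_sub, mul_div_cancel₀ _ hN0'.ne', ← boxCount_eq_card, boxCount,
      ← hV]
    have : (N : ℝ) * V = ∑ n ∈ Finset.range N, V := by simp
    rw [this, ← Finset.sum_sub_distrib]
    refine Finset.sum_congr rfl fun n hn => ?_
    have hn' := sumOfDigits_le hq ((Finset.mem_range.1 hn).trans hN)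
    rw [min_eq_left (by omega), min_eq_left (by omega)]
    simp only [S, boxCount, Finset.sum_range_succ]
    push_cast
    ring
  rw [e, abs_mul, Nat.abs_cast] at hsum
  refine le_of_mul_le_mul_left (hsum.trans ?_) hN0'
  have hN'' : (q : ℝ) ^ m ≤ q * N := by exact_mod_cast hN'
  calc _ ≤ 6 * (q : ℝ) ^ 2 * ((q * N) / √(m + 1)) * E := by gcongr
    _ = _ := by ring

/-- The estimate is used with m ≍ log N and F = O(log log N); the constant is uniform over all x
with the same bases and C. -/
theorem exists_discrepancy_comp_sumOfDigits_le {q : ℕ} (hq : 2 ≤ q) {s : ℕ} {b : Fin s → ℕ}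
    (hb : ∀ i, 2 ≤ b i) {C : ℝ} (hC : 0 < C) :
    ∃ c : ℝ, 0 < c ∧ ∀ x : ℕ → Fin s → ℝ, HasAdicDeviation x b C → ∀ N : ℕ, 3 ≤ N →
      discrepancy (fun n => x (sumOfDigits q n)) N ≤
        c * Real.log (Real.log N) ^ s / √(Real.log N) := by
  have hq' : (2 : ℝ) ≤ q := by exact_mod_cast hq
  have hl3 : 1 < Real.log 3 := by
    rw [Real.lt_log_iff_exp_lt (by norm_num)]
    exact Real.exp_one_lt_d9.trans (by norm_num)
  -- As log log N ≥ L₀ > 0 for N ≥ 3, additive constants are absorbed through 1 ≤ (log log N)/L₀.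
  set L₀ := Real.log (Real.log 3) with hL₀
  have hL₀pos : 0 < L₀ := Real.log_pos hl3
  have hc0 : 0 < Real.log (5 * q) := Real.log_pos (by linarith)
  -- From qm + 1 ≤ 5q·log N and log 2 > 1/2 comes F ≤ 2(log(5q) + log log N) + 1, hence F ≤ D·log
  -- log N.
  set D : ℝ := (2 * Real.log (5 * q) + 1) / L₀ + 2 with hD
  have hD0 : 0 < D := by positivity
  set A : Fin s → ℝ := fun i => 2 * (1 / L₀ + D * b i) with hA
  have hA0 : ∀ i, 0 < A i := fun i => by positivity
  have hAp : 0 < ∏ i, A i := Finset.prod_pos fun i _ => hA0 i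
  refine ⟨6 * (q : ℝ) ^ 3 * q * (C * ∏ i, A i + 2 * s * (1 / L₀) ^ s), by positivity,
    fun x hx N hN => discrepancy_le fun a c hac => ?_⟩
  set ℓ := Real.log N with hℓ
  have hℓ3 : Real.log 3 ≤ ℓ := Real.log_le_log (by norm_num) (by exact_mod_cast hN)
  have hℓ1 : 1 < ℓ := hl3.trans_le hℓ3
  set L := Real.log ℓ with hL
  have hLL : L₀ ≤ L := Real.log_le_log (by linarith) hℓ3
  have hL0 : 0 < L := hL₀pos.trans_le hLL
  have hone : 1 ≤ 1 / L₀ * L := by rw [one_div_mul_eq_div, one_le_div hL₀pos]; exact hLL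
  set m := Nat.log q N + 1 with hm
  set F := Nat.log 2 (q * m + 1) + 1 with hF
  have hm4 : (m : ℝ) ≤ 4 * ℓ := by
    have := log_add_one_le_four_mul_log hq hN
    push_cast [hm]
    exact this
  have hNm : N < q ^ m := Nat.lt_pow_succ_log_self (by omega) N
  have hNm' : q ^ m ≤ q * N := by
    rw [hm, pow_succ']
    exact Nat.mul_le_mul_left q (Nat.pow_log_le_self q (by omega))
  have hFD : (F : ℝ) ≤ D * L := by
    have h1 : (Nat.log 2 (q * m + 1) : ℝ) * Real.log 2 ≤ Real.log (5 * q) + L := by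
      rw [← Real.log_pow, hL, ← Real.log_mul (by positivity) (by linarith)]
      refine Real.log_le_log (by positivity) ?_
      have h2 : (2 : ℝ) ^ Nat.log 2 (q * m + 1) ≤ q * m + 1 := by
        exact_mod_cast Nat.pow_log_le_self 2 (by omega)
      nlinarith
    have h2 := Real.log_two_gt_d9
    have h3 : (Nat.log 2 (q * m + 1) : ℝ) ≤ 2 * (Real.log (5 * q) + L) := by
      nlinarith [Nat.cast_nonneg (α := ℝ) (Nat.log 2 (q * m + 1))]
    have h4 : 2 * Real.log (5 * q) + 1 ≤ (2 * Real.log (5 * q) + 1) / L₀ * L := by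
      rw [div_mul_eq_mul_div, le_div_iff₀ hL₀pos]
      gcongr
    rw [hD, hF]
    push_cast
    linarith
  have hE : C * ∏ i, (2 * (1 + F * (b i : ℝ))) + 2 * s ≤
      (C * ∏ i, A i + 2 * s * (1 / L₀) ^ s) * L ^ s := by
    have h1 : ∏ i, (2 * (1 + F * (b i : ℝ))) ≤ (∏ i, A i) * L ^ s := by
      calc _ ≤ ∏ i, (A i * L) := by
            refine Finset.prod_le_prod (fun i _ => by positivity) fun i _ => ?_
            have := mul_le_mul_of_nonneg_right hFD (Nat.cast_nonneg (α := ℝ) (b i))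
            simp only [hA]
            linarith
        _ = _ := by rw [Finset.prod_mul_distrib]; simp
    have h2 : 1 ≤ (1 / L₀) ^ s * L ^ s := by
      rw [← mul_pow]
      exact one_le_pow₀ hone
    have h3 := mul_le_mul_of_nonneg_left h1 hC.le
    have h4 := mul_le_mul_of_nonneg_left h2 (by positivity : (0 : ℝ) ≤ 2 * s)
    linarith
  have hsq : 1 / √((m : ℝ) + 1) ≤ q / √ℓ := by
    have h1 : ℓ ≤ m * q := by
      have h2 : ℓ ≤ m * Real.log q := by
        rw [← Real.log_pow]
        exact Real.log_le_log (by positivity) (by exact_mod_cast hNm.le)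
      have h3 : Real.log q ≤ q := Real.log_le_self (by positivity)
      exact h2.trans (by gcongr)
    rw [div_le_div_iff₀ (by positivity) (by positivity), one_mul, Real.sqrt_le_left (by positivity),
      mul_pow, Real.sq_sqrt (by positivity)]
    nlinarith [Nat.cast_nonneg (α := ℝ) m]
  refine (hx.abs_localDiscrepancy_comp_sumOfDigits_le hq hb hC.le (by omega) hNm hNm'
    (Nat.lt_pow_succ_log_self one_lt_two _).le hac).trans ?_
  calc _ = 6 * (q : ℝ) ^ 3 * (1 / √(m + 1)) * (C * ∏ i, (2 * (1 + F * (b i : ℝ))) + 2 * s) := by ring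
    _ ≤ 6 * (q : ℝ) ^ 3 * (q / √ℓ) * ((C * ∏ i, A i + 2 * s * (1 / L₀) ^ s) * L ^ s) := by
        have h0 : 0 ≤ ∏ i, (2 * (1 + (F : ℝ) * (b i : ℝ))) :=
          Finset.prod_nonneg fun i _ => by positivity
        gcongr
    _ = _ := by ring

theorem IsTSSequence.mem_Ico {b t s : ℕ} (hb : 2 ≤ b) {x : ℕ → Fin s → ℝ}
    (hx : IsTSSequence b t s x) (n : ℕ) (i : Fin s) : x n i ∈ Set.Ico (0 : ℝ) 1 := by
  have h := (hx (n / b ^ t) t le_rfl).2.1 ⟨n % b ^ t, Nat.mod_lt _ (by positivity)⟩ i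
  simpa only [mul_comm (n / b ^ t), Nat.div_add_mod] using h

theorem mainTheorem3 (q : ℕ) (hq : 2 ≤ q) :
    ∃ c₂ : ℝ, 0 < c₂ ∧
      (∀ (s : ℕ), 1 ≤ s → ∀ b : Fin s → ℕ, (∀ i, 2 ≤ b i) →
        Pairwise (fun i j => Nat.Coprime (b i) (b j)) →
        ∃ c₄ : ℝ, 0 < c₄ ∧ ∀ N : ℕ, 3 ≤ N →
          c₂ / Real.sqrt (Real.log N) ≤
              discrepancy (fun n => haltonSeq b (sumOfDigits q n)) N ∧
            discrepancy (fun n => haltonSeq b (sumOfDigits q n)) N ≤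
              c₄ * Real.log (Real.log N) ^ s / Real.sqrt (Real.log N)) ∧
      (∀ (b s t : ℕ), 2 ≤ b → 1 ≤ s →
        ∃ c₅ : ℝ, 0 < c₅ ∧ ∀ x : ℕ → Fin s → ℝ, IsTSSequence b t s x → ∀ N : ℕ, 3 ≤ N →
          c₂ / Real.sqrt (Real.log N) ≤
              discrepancy (fun n => x (sumOfDigits q n)) N ∧
            discrepancy (fun n => x (sumOfDigits q n)) N ≤
              c₅ * Real.log (Real.log N) ^ s / Real.sqrt (Real.log N)) := by
  refine ⟨1 / (8 * (q : ℝ) ^ 2), by positivity, fun s hs b hb hco => ?_, fun b s t hb hs => ?_⟩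
  · obtain ⟨c, hc, h⟩ := exists_discrepancy_comp_sumOfDigits_le hq hb one_pos
    exact ⟨c, hc, fun N hN => ⟨le_discrepancy_comp_sumOfDigits hq hs
      (fun n i => radicalInverse_mem_Ico (hb i) n) hN,
      h _ (hasAdicDeviation_haltonSeq hb hco) N hN⟩⟩
  · obtain ⟨c, hc, h⟩ := exists_discrepancy_comp_sumOfDigits_le hq (s := s) (b := fun _ => b)
      (fun _ => hb) (C := (b : ℝ) ^ t) (by positivity)
    exact ⟨c, hc, fun x hx N hN => ⟨le_discrepancy_comp_sumOfDigits hq hs (hx.mem_Ico hb) hN,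
      h x (hx.hasAdicDeviation hb) N hN⟩⟩
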